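/- A base station (BS) and $N$ energy-harvesting users (EHUs) operate in slots $i=1,2,\dots$, with uplink and downlink transmission at the same time in two frequency bands. In slot $i$ EHU $n$ has normalized uplink and downlink power gains $x_n(i)\ge 0$ and $y_n(i)\ge 0$. The vector processes $(x_1(i),\dots,x_N(i))_i$ and $(y_1(i),\dots,y_N(i))_i$ are stationary and ergodic, their gains have finite mean, and in a slot each vector is continuously distributed in the sense that no hyperplane of $\mathbb R^N$ has positive probability. Let $N_0>0$, $0<\eta<1$, $\varepsilon>1$, $\eta'=\eta N_0/\varepsilon$, $0<P_{avg}\le P_{max}$, and let $\mu_1\ge\dots\ge\mu_N>0$ with $\sum_n\mu_n=1$. Write $E[u(i)]=\lim_{M\to\infty}\frac1M\sum_{i=1}^M u(i)$ for time averages. A policy consists of desired powers $P_{d,n}(i)\ge0$ of the EHUs and powers $0\le P_0(i)\le P_{max}$ of the BS with $\limsup_{M\to\infty}\frac1M\sum_{i=1}^M P_0(i)\le P_{avg}$. EHU $n$ has a battery of unlimited capacity with content $B_n(0)\ge 0$ at the start, transmits with power $P_{out,n}(i)=\min\{B_n(i-1)/\varepsilon,\,P_{d,n}(i)\}$, and $B_n(i)=B_n(i-1)+\eta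 N_0P_0(i)y_n(i)-\varepsilon P_{out,n}(i)$. Its rate in slot $i$ is $$R_n(i)=\log_2\Bigl(1+\frac{P_{out,n}(i)x_n(i)}{1+\sum_{k<n}P_{out,k}(i)x_k(i)}\Bigr).$$ The problem with batteries is to maximize $\sum_n\mu_nE[R_n(i)]$ over all policies. The problem without batteries is to maximize the same quantity with $P_{out,n}(i)$ replaced by $P_{d,n}(i)$, over the policies for which, for every $n$, $\lim_{M\to\infty}\frac1M\sum_{i=1}^M\bigl(P_{d,n}(i)-\eta'P_0(i)y_n(i)\bigr)=0$. For $\lambda_1,\dots,\lambda_N>0$ and $\lambda_0\ge0$ define a policy that uses only the current gains as follows. In slot $i$ let $n_1<\dots<n_l$ be the users $n$ for which there is a $z\ge 0$ such that $\frac{\mu_n}{1+z}-\frac{\lambda_n}{x_n(i)}$ is positive and larger than $\frac{\mu_k}{1+z}-\frac{\lambda_k}{x_k(i)}$ for all $k\ne n$ (so the space of gain vectors is divided into $2^N$ disjoint regions, some possibly empty). Put $P_s^*(i)=0$ for $s\notin\{n_1,\dots,n_l\}$ and $P_{n_m}^*(i)=U_m-D_m$, where $$U_m=\frac{\mu_{n_m}-\mu_{n_{m+1}}}{\lambda_{n_m}-\lambda_{n_{m+1}}x_{n_m}(i)/x_{n_{m+1}}(i)}\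 (m<l),\qquad U_l=\frac{\mu_{n_l}}{\lambda_{n_l}},$$ $$D_1=\frac1{x_{n_1}(i)},\qquad D_m=\frac{\mu_{n_{m-1}}-\mu_{n_m}}{-\lambda_{n_m}+\lambda_{n_{m-1}}x_{n_m}(i)/x_{n_{m-1}}(i)}\ (m>1).$$ Let $P_0^*(i)=P_{max}$ if $\sum_n\lambda_ny_n(i)\ge\lambda_0/\eta'$, and $P_0^*(i)=0$ otherwise. Then there are constants $\lambda_1,\dots,\lambda_N>0$ and $\lambda_0\ge0$ (Lagrange multipliers) such that, almost surely, $$\lim_{M\to\infty}\frac1M\sum_{i=1}^M\bigl(P_n^*(i)-\eta'P_0^*(i)y_n(i)\bigr)=0\ \ (n=1,\dots,N),\qquad E[P_0^*(i)]=P_{avg}.\qquad(\ast)$$ For all constants $\lambda_1,\dots,\lambda_N>0$, $\lambda_0\ge0$ that satisfy $(\ast)$ almost surely, the following holds almost surely. In every slot, $P_n^*(i)>0$ for exactly the users $n\in\{n_1,\dots,n_l\}$. The policy $P_{d,n}(i)=P_n^*(i)$, $P_0(i)=P_0^*(i)$ is optimal for the problem with batteries, for all initial contents $B_n(0)\ge0$,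 and for the problem without batteries: it satisfies the constraints; with it, the time average of the rate of each EHU $n$ exists, and is the same deterministic constant $\bar R_n$ in both problems; and for every policy that satisfies the constraints of the problem in question (policies that know all gains in advance included) the upper limit of the averages over $M$ slots of the weighted sum of rates is at most $\sum_n\mu_n\bar R_n$. -/

import Mathlib

open Filter Topology MeasureTheory

namespace FDT

/-- Constants of the system with `N` energy-harvesting users (EHUs): noise power `N₀`, conversion
efficiency `η`, amplifier inefficiency `ε`, peak and average power of the base station (BS), and
the priority weights `μ` (ordered decreasingly, as one may by relabelling the users). -/
structure System (N : ℕ) where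
  N₀ : ℝ
  η : ℝ
  ε : ℝ
  Pmax : ℝ
  Pavg : ℝ
  μ : Fin N → ℝ
  N₀_pos : 0 < N₀
  η_pos : 0 < η
  η_lt_one : η < 1
  one_lt_ε : 1 < ε
  Pavg_pos : 0 < Pavg
  Pavg_le : Pavg ≤ Pmax
  μ_pos : ∀ n, 0 < μ n
  μ_antitone : Antitone μ
  μ_sum : ∑ n, μ n = 1

variable {N : ℕ}

/-- The constant `η' = η N₀ / ε`. -/
noncomputable def System.η' (s : System N) : ℝ := s.η * s.N₀ / s.ε

/-! ### Time averages -/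

/-- Average of `u` over the first `M` slots (slots are numbered `0, 1, 2, …`). -/
noncomputable def avg (u : ℕ → ℝ) (M : ℕ) : ℝ := (∑ i ∈ Finset.range M, u i) / M

/-- `limsup_{M → ∞} u M ≤ a`. -/
def LimsupLE (u : ℕ → ℝ) (a : ℝ) : Prop := ∀ δ > 0, ∀ᶠ M in atTop, u M ≤ a + δ

/-! ### Policies, batteries and rates along one realization of the gains

`x i n` and `y i n` are the normalized uplink and downlink power gains of EHU `n` in slot `i`. -/

/-- Desired transmit powers `pd i n` of the EHUs and output powers `p0 i` of the BS. -/
structure Policy (N : ℕ) where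
  pd : ℕ → Fin N → ℝ
  p0 : ℕ → ℝ

/-- `battery s b y p n i` is the content of the (unlimited) battery of EHU `n` at the beginning of
slot `i`, when `b n` is its initial content. -/
noncomputable def battery (s : System N) (b : Fin N → ℝ) (y : ℕ → Fin N → ℝ) (p : Policy N)
    (n : Fin N) : ℕ → ℝ
  | 0 => b n
  | i + 1 => battery s b y p n i + s.η * s.N₀ * p.p0 i * y i n
      - s.ε * min (battery s b y p n i / s.ε) (p.pd i n)

/-- Power with which EHU `n` actually transmits in slot `i`. -/
noncomputable def pout (s : System N) (b : Fin N → ℝ) (y : ℕ → Fin N → ℝ) (p : Policy N)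
    (i : ℕ) (n : Fin N) : ℝ :=
  min (battery s b y p n i / s.ε) (p.pd i n)

/-- Rate of EHU `n` in a slot with uplink gains `g` and transmit powers `P`, under successive
interference cancellation in the order `N, N - 1, …, 1`. -/
noncomputable def rate (g P : Fin N → ℝ) (n : Fin N) : ℝ :=
  Real.logb 2 (1 + P n * g n / (1 + ∑ k ∈ Finset.univ.filter (· < n), P k * g k))

/-- Nonnegative powers, and the peak and average power constraints at the BS. -/
def Admissible (s : System N) (p : Policy N) : Prop :=
  (∀ i n, 0 ≤ p.pd i n) ∧ (∀ i, 0 ≤ p.p0 i ∧ p.p0 i ≤ s.Pmax) ∧ LimsupLE (avg p.p0) s.Pavg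

/-- `p` solves the problem with batteries: the time average of the rate of each EHU `n` is `R n`,
and no admissible policy (noncausal ones included) has a larger weighted sum of rates, even in the
sense of the upper limit. -/
def IsOptimal (s : System N) (b : Fin N → ℝ) (x y : ℕ → Fin N → ℝ) (p : Policy N)
    (R : Fin N → ℝ) : Prop :=
  Admissible s p ∧
  (∀ n, Tendsto (avg fun i => rate (x i) (pout s b y p i) n) atTop (𝓝 (R n))) ∧
  ∀ q : Policy N, Admissible s q →
    LimsupLE (avg fun i => ∑ n, s.μ n * rate (x i) (pout s b y q i) n) (∑ n, s.μ n * R n)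

/-- For each EHU, the time average of the desired power equals that of the harvested power
(in terms of transmit power). -/
def EnergyBalance (s : System N) (y : ℕ → Fin N → ℝ) (p : Policy N) : Prop :=
  ∀ n, Tendsto (fun M => avg (fun i => p.pd i n) M - avg (fun i => s.η' * p.p0 i * y i n) M)
    atTop (𝓝 0)

/-- `p` solves the problem without batteries, in which the desired powers are transmitted and the
batteries are replaced by the energy balance. -/
def IsOptimalBalanced (s : System N) (x y : ℕ → Fin N → ℝ) (p : Policy N) (R : Fin N → ℝ) : Prop :=
  (Admissible s p ∧ EnergyBalance s y p) ∧
  (∀ n, Tendsto (avg fun i => rate (x i) (p.pd i) n) atTop (𝓝 (R n))) ∧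
  ∀ q : Policy N, Admissible s q → EnergyBalance s y q →
    LimsupLE (avg fun i => ∑ n, s.μ n * rate (x i) (q.pd i) n) (∑ n, s.μ n * R n)

/-! ### The proposed powers -/

/-- The set of transmitting users for the (positive) uplink gains `g`. User `n` transmits iff at some
interference level `z ≥ 0` its net marginal value `μ n / (1 + z) - lam n / g n` is positive and
exceeds that of every other user. The `2 ^ N` possible values of this set index the regions into
which the space of gain vectors is divided. -/
def activeSet (μ lam g : Fin N → ℝ) : Set (Fin N) :=
  {n | ∃ z : ℝ, 0 ≤ z ∧ 0 < μ n / (1 + z) - lam n / g n ∧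
    ∀ k, k ≠ n → μ k / (1 + z) - lam k / g k < μ n / (1 + z) - lam n / g n}

open scoped Classical in
/-- First term of the power of user `n`, when `J` is the set of transmitting users; `m` is the next
transmitting user after `n`. -/
noncomputable def upperTerm (μ lam g : Fin N → ℝ) (J : Set (Fin N)) (n : Fin N) : ℝ :=
  if h : (Finset.univ.filter fun k => k ∈ J ∧ n < k).Nonempty then
    let m := (Finset.univ.filter fun k => k ∈ J ∧ n < k).min' h
    (μ n - μ m) / (lam n - lam m * g n / g m)
  else μ n / lam n

open scoped Classical in
/-- Subtracted term of the power of user `n`, when `J` is the set of transmitting users; `m` is the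
last transmitting user before `n`. -/
noncomputable def lowerTerm (μ lam g : Fin N → ℝ) (J : Set (Fin N)) (n : Fin N) : ℝ :=
  if h : (Finset.univ.filter fun k => k ∈ J ∧ k < n).Nonempty then
    let m := (Finset.univ.filter fun k => k ∈ J ∧ k < n).max' h
    (μ m - μ n) / (-lam n + lam m * g n / g m)
  else 1 / g n

open scoped Classical in
/-- The power `P_n^*` of EHU `n` for the uplink gains `g`. -/
noncomputable def ehuPower (μ lam g : Fin N → ℝ) (n : Fin N) : ℝ :=
  if n ∈ activeSet μ lam g then
    upperTerm μ lam g (activeSet μ lam g) n - lowerTerm μ lam g (activeSet μ lam g) n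
  else 0

open scoped Classical in
/-- The on-off power `P_0^*` of the BS for the downlink gains `h`. -/
noncomputable def bsPower (s : System N) (lam : Fin N → ℝ) (lam0 : ℝ) (h : Fin N → ℝ) : ℝ :=
  if lam0 / s.η' ≤ ∑ n, lam n * h n then s.Pmax else 0

/-- The proposed policy; in each slot it uses the current gains only. -/
noncomputable def starPolicy (s : System N) (lam : Fin N → ℝ) (lam0 : ℝ)
    (x y : ℕ → Fin N → ℝ) : Policy N where
  pd i := ehuPower s.μ lam (x i)
  p0 i := bsPower s lam lam0 (y i)

/-- The equations that determine the multipliers: the energy balance, and the average power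
constraint at the BS with equality. -/
def MultiplierEquations (s : System N) (lam : Fin N → ℝ) (lam0 : ℝ)
    (x y : ℕ → Fin N → ℝ) : Prop :=
  EnergyBalance s y (starPolicy s lam lam0 x y) ∧
  Tendsto (avg (starPolicy s lam lam0 x y).p0) atTop (𝓝 s.Pavg)

/-! ### Fading processes -/

/-- The vector-valued process `g` is stationary and ergodic: the shift preserves its law on the
space of sequences, and is ergodic for it. -/
def StationaryErgodic {Ω : Type*} [MeasurableSpace Ω] (ℙ : Measure Ω)
    (g : ℕ → Ω → Fin N → ℝ) : Prop :=
  (∀ i, Measurable (g i)) ∧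
  Ergodic (fun (w : ℕ → Fin N → ℝ) (i : ℕ) => w (i + 1)) (ℙ.map fun ω i => g i ω)

/-- A block fading process: stationary and ergodic, with nonnegative gains of finite mean, whose
distribution in a slot is continuous in the sense that no hyperplane has positive probability. -/
structure IsFading {Ω : Type*} [MeasurableSpace Ω] (ℙ : Measure Ω)
    (g : ℕ → Ω → Fin N → ℝ) : Prop where
  stationaryErgodic : StationaryErgodic ℙ g
  nonneg : ∀ i ω n, 0 ≤ g i ω n
  integrable : ∀ n, Integrable (fun ω => g 0 ω n) ℙ
  hyperplane : ∀ c : Fin N → ℝ, c ≠ 0 → ∀ d : ℝ, ℙ {ω | ∑ n, c n * g 0 ω n = d} = 0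

end FDT

/-! The proof is Lagrangian duality, carried out slot by slot and then averaged by the ergodic
theorem.

With multipliers fixed, a slot splits into two maximizations. The BS term is linear in the BS power,
so an on-off power is best (`mul_le_bsPower_mul`). For the users, stack the received powers above
the noise level 1 in the order of their indices: user `n` occupies an interval of levels, and its
weighted rate less its price is the integral over that interval of the marginal value `μ n / t - c
n`, with `c n = lam n / g n`. The total is therefore at most the integral of the positive upper
envelope of the marginals (`sum_le_netValue`). Since the weights decrease, the levels at which
successive users lead are consecutive intervals, up to finitely many points, so giving each user the
levels at which it leads attains the bound (`sum_eq_netValue`). The endpoints of these intervals are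
the crossing points of the marginals, which is the explicit formula (`ehuPower_eq_power`).

Averaging the slotwise inequality along one realization gives optimality against every policy,
noncausal ones included, because the multiplier equations make the constraint terms of the proposed
policy vanish in the limit (`limsupLE_weightedRate`). A battery only enforces the one-sided form of
the energy balance. Conversely, under the balance, shortages have zero average
(`limsupLE_shortfall`); as the proposed powers are bounded and the gains have small tails, the rates
lose nothing on average (`tendsto_avg_rate_pout`).

The multipliers minimize the dual function. It is bounded below by affine functions whose slopes,
the energy and power gaps, depend continuously on the multipliers because ties have probability
zero. Coercivity gives a minimizer (`exists_dual_min`), and there the gaps vanish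
(`exists_multipliers`). -/

/-! ### The pointwise ergodic theorem -/

namespace Birkhoff

variable {α : Type*}

/-- `maxSum T f n x` is the maximum of the first `n + 1` Birkhoff sums of `f` at `x`, the empty sum
included. -/
noncomputable def maxSum (T : α → α) (f : α → ℝ) : ℕ → α → ℝ
  | 0, _ => 0
  | n + 1, x => max 0 (f x + maxSum T f n (T x))

theorem maxSum_nonneg (T : α → α) (f : α → ℝ) (n : ℕ) (x : α) : 0 ≤ maxSum T f n x := by
  cases n with
  | zero => exact le_rfl
  | succ n => exact le_max_left _ _

theorem maxSum_le_succ (T : α → α) (f : α → ℝ) (n : ℕ) :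
    ∀ x, maxSum T f n x ≤ maxSum T f (n + 1) x := by
  induction n with
  | zero => exact fun x => maxSum_nonneg T f 1 x
  | succ n ih =>
    intro x
    exact max_le_max le_rfl (add_le_add le_rfl (ih (T x)))

theorem maxSum_monotone (T : α → α) (f : α → ℝ) (x : α) : Monotone fun n => maxSum T f n x :=
  monotone_nat_of_le_succ fun n => maxSum_le_succ T f n x

theorem birkhoffSum_le_maxSum (T : α → α) (f : α → ℝ) (n : ℕ) :
    ∀ x, birkhoffSum T f n x ≤ maxSum T f n x := by
  induction n with
  | zero => intro x; simp [birkhoffSum_zero, maxSum]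
  | succ n ih =>
    intro x
    rw [birkhoffSum_succ']
    exact (add_le_add le_rfl (ih (T x))).trans (le_max_right _ _)

/-- As `n` grows the right side decreases to `f x` wherever the maxima at `T x` are unbounded. This
drives the ergodic theorem. -/
theorem maxSum_succ_sub (T : α → α) (f : α → ℝ) (n : ℕ) (x : α) :
    maxSum T f (n + 1) x - maxSum T f n (T x) = max (-maxSum T f n (T x)) (f x) := by
  change max 0 (f x + maxSum T f n (T x)) - maxSum T f n (T x) = _
  rw [← max_sub_sub_right, zero_sub, add_sub_cancel_right]

/-- Passing from `x` to `T x` changes the maxima by a bounded amount, so boundedness is an exactly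
invariant property and ergodicity gives it probability 0 or 1. -/
theorem exists_maxSum_le_comp_iff (T : α → α) (f : α → ℝ) (x : α) :
    (∃ C : ℕ, ∀ n, maxSum T f n (T x) ≤ C) ↔ ∃ C : ℕ, ∀ n, maxSum T f n x ≤ C := by
  constructor
  · rintro ⟨C, hC⟩
    obtain ⟨D, hD⟩ := exists_nat_ge (f x + C)
    refine ⟨D, fun n => ?_⟩
    cases n with
    | zero => exact Nat.cast_nonneg _
    | succ n => exact max_le (Nat.cast_nonneg _) (by linarith [hC n])
  · rintro ⟨C, hC⟩
    obtain ⟨D, hD⟩ := exists_nat_ge (C - f x)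
    refine ⟨D, fun n => ?_⟩
    have h1 : f x + maxSum T f n (T x) ≤ maxSum T f (n + 1) x := le_max_right _ _
    linarith [hC (n + 1)]

variable [MeasurableSpace α] {μ : Measure α} {T : α → α} {f : α → ℝ}

theorem measurable_maxSum (hT : Measurable T) (hf : Measurable f) (n : ℕ) :
    Measurable (maxSum T f n) := by
  induction n with
  | zero => exact measurable_const
  | succ n ih => exact measurable_const.max (hf.add (ih.comp hT))

theorem integrable_maxSum (hT : MeasurePreserving T μ μ) (hf : Integrable f μ) (n : ℕ) :
    Integrable (maxSum T f n) μ := by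
  induction n with
  | zero => exact integrable_zero _ _ _
  | succ n ih =>
    have := (integrable_zero α ℝ μ).sup (hf.add (hT.integrable_comp_of_integrable ih))
    exact this

/-- The Birkhoff sums of a function with negative mean are almost surely bounded above. -/
theorem ae_exists_birkhoffSum_le [IsProbabilityMeasure μ] (hT : Ergodic T μ) (hfm : Measurable f)
    (hf : Integrable f μ) (hneg : ∫ x, f x ∂μ < 0) :
    ∀ᵐ x ∂μ, ∃ C : ℕ, ∀ n, birkhoffSum T f n x ≤ C := by
  have hTm := hT.measurable
  set A : Set α := {x | ∃ C : ℕ, ∀ n, maxSum T f n x ≤ C} with hA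
  have hAm : MeasurableSet A := by
    have : A = ⋃ C : ℕ, ⋂ n, {x | maxSum T f n x ≤ C} := by ext x; simp [hA]
    rw [this]
    exact MeasurableSet.iUnion fun C => MeasurableSet.iInter fun n =>
      measurableSet_le (measurable_maxSum hTm hfm n) measurable_const
  have hTA : T ⁻¹' A = A := by
    ext x
    exact exists_maxSum_le_comp_iff T f x
  rcases hT.toPreErgodic.ae_mem_or_ae_notMem hAm hTA with h | h
  · filter_upwards [h] with x hx
    obtain ⟨C, hC⟩ := hx
    exact ⟨C, fun n => (birkhoffSum_le_maxSum T f n x).trans (hC n)⟩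
  · exfalso
    have hmp := hT.toMeasurePreserving
    -- If the maxima were almost surely unbounded, these integrals would tend to the negative mean
    -- of `f`. Yet each is the mean of `maxSum T f (n + 1)` less that of `maxSum T f n ∘ T`, which
    -- is nonnegative by monotonicity and invariance of `μ`.
    have hlim : Tendsto (fun n => ∫ x, max (-maxSum T f n (T x)) (f x) ∂μ) atTop
        (𝓝 (∫ x, f x ∂μ)) := by
      refine tendsto_integral_of_dominated_convergence (fun x => |f x|) (fun n => ?_) hf.abs
        (fun n => ?_) ?_
      · exact (((measurable_maxSum hTm hfm n).comp hTm).neg.max hfm).aestronglyMeasurable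
      · refine Eventually.of_forall fun x => ?_
        rw [Real.norm_eq_abs, abs_le]
        exact ⟨(neg_abs_le _).trans (le_max_right _ _),
          max_le ((neg_nonpos.2 (maxSum_nonneg T f n _)).trans (abs_nonneg _)) (le_abs_self _)⟩
      · filter_upwards [h] with x hx
        have hx' : ¬ ∃ C : ℕ, ∀ n, maxSum T f n (T x) ≤ C := by
          rw [exists_maxSum_le_comp_iff]; exact hx
        push Not at hx'
        obtain ⟨D, hD⟩ := exists_nat_ge (-f x)
        obtain ⟨m, hm⟩ := hx' D
        refine tendsto_const_nhds.congr' ?_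
        filter_upwards [eventually_ge_atTop m] with n hn
        have h1 := maxSum_monotone T f (T x) hn
        simp only at h1
        exact (max_eq_right (by linarith)).symm
    have hnn : ∀ n, 0 ≤ ∫ x, max (-maxSum T f n (T x)) (f x) ∂μ := by
      intro n
      simp_rw [← maxSum_succ_sub T f n]
      have hi := integrable_maxSum hmp hf
      have h2 : Integrable (fun x => maxSum T f n (T x)) μ :=
        hmp.integrable_comp_of_integrable (hi n)
      rw [integral_sub (hi (n + 1)) h2]
      have h1 : ∫ x, maxSum T f n (T x) ∂μ = ∫ x, maxSum T f n x ∂μ := by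
        have := integral_map hTm.aemeasurable (μ := μ) (f := maxSum T f n)
          (measurable_maxSum hTm hfm n).aestronglyMeasurable
        rw [hmp.map_eq] at this
        exact this.symm
      rw [h1, sub_nonneg]
      exact integral_mono (hi n) (hi (n + 1)) (maxSum_le_succ T f n)
    exact absurd (ge_of_tendsto' hlim hnn) (not_le.2 hneg)

/-- Subtracting slightly more than the mean makes the mean negative, and then bounded Birkhoff sums
disappear after division by `n`. Margins `1 / (k + 1)` keep the exceptional sets countable in
number. -/
theorem ae_limsup_birkhoffSum_le [IsProbabilityMeasure μ] (hT : Ergodic T μ) (hfm : Measurable f)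
    (hf : Integrable f μ) :
    ∀ᵐ x ∂μ, ∀ δ > 0, ∀ᶠ n : ℕ in atTop, birkhoffSum T f n x / n ≤ ∫ x, f x ∂μ + δ := by
  have key : ∀ k : ℕ, ∀ᵐ x ∂μ, ∃ C : ℕ, ∀ n,
      birkhoffSum T (fun x => f x - (∫ x, f x ∂μ + 1 / (k + 1 : ℝ))) n x ≤ C := by
    intro k
    refine ae_exists_birkhoffSum_le hT (hfm.sub_const _) (hf.sub (integrable_const _)) ?_
    rw [integral_sub hf (integrable_const _)]
    simp only [integral_const, probReal_univ, one_smul]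
    have : 0 < 1 / ((k : ℝ) + 1) := by positivity
    linarith
  filter_upwards [ae_all_iff.2 key] with x hx δ hδ
  obtain ⟨k, hk⟩ := exists_nat_one_div_lt (half_pos hδ)
  obtain ⟨C, hC⟩ := hx k
  filter_upwards [eventually_gt_atTop 0,
    (tendsto_const_div_atTop_nhds_zero_nat (C : ℝ)).eventually (gt_mem_nhds (half_pos hδ))]
    with n hn hn2
  have hn' : (0 : ℝ) < n := Nat.cast_pos.2 hn
  have h1 := hC n
  simp only [birkhoffSum, Finset.sum_sub_distrib, Finset.sum_const, Finset.card_range,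
    nsmul_eq_mul] at h1 ⊢
  rw [div_lt_iff₀ hn'] at hn2
  rw [div_le_iff₀ hn']
  nlinarith

/-- Birkhoff's pointwise ergodic theorem, for an ergodic transformation. -/
theorem ae_tendsto_birkhoffSum_div [IsProbabilityMeasure μ] (hT : Ergodic T μ)
    (hfm : Measurable f) (hf : Integrable f μ) :
    ∀ᵐ x ∂μ, Tendsto (fun n : ℕ => birkhoffSum T f n x / n) atTop (𝓝 (∫ x, f x ∂μ)) := by
  filter_upwards [ae_limsup_birkhoffSum_le hT hfm hf, ae_limsup_birkhoffSum_le hT hfm.neg hf.neg]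
    with x h1 h2
  rw [Metric.tendsto_atTop']
  intro δ hδ
  have h3 := (h1 (δ / 2) (half_pos hδ)).and (h2 (δ / 2) (half_pos hδ))
  obtain ⟨n, hn⟩ := eventually_atTop.1 h3
  refine ⟨n, fun m hm => ?_⟩
  obtain ⟨h4, h5⟩ := hn m hm.le
  simp only [Pi.neg_apply, integral_neg, birkhoffSum, Finset.sum_neg_distrib, neg_div] at h4 h5
  rw [Real.dist_eq, abs_lt]
  simp only [birkhoffSum]
  constructor <;> linarith

end Birkhoff

/-! ### Stationary ergodic gain processes: passage between one slot and the whole path -/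

namespace FDT

variable {N : ℕ} {Ω : Type*} [MeasurableSpace Ω] {ℙ : Measure Ω} {g : ℕ → Ω → Fin N → ℝ}

theorem iterate_shift_apply {β : Type*} (i : ℕ) :
    ∀ (w : ℕ → β) (j : ℕ), (fun (w : ℕ → β) (i : ℕ) => w (i + 1))^[i] w j = w (j + i) := by
  induction i with
  | zero => exact fun w j => rfl
  | succ i ih =>
    intro w j
    rw [Function.iterate_succ_apply, ih]
    rfl

theorem iterate_shift_apply_zero {β : Type*} (i : ℕ) (w : ℕ → β) :
    (fun (w : ℕ → β) (i : ℕ) => w (i + 1))^[i] w 0 = w i := by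
  rw [iterate_shift_apply, zero_add]

theorem StationaryErgodic.measurable_path (h : StationaryErgodic ℙ g) :
    Measurable fun ω i => g i ω :=
  measurable_pi_lambda _ h.1

theorem StationaryErgodic.map_eq (h : StationaryErgodic ℙ g) (i : ℕ) :
    ℙ.map (g i) = ℙ.map (g 0) := by
  set S : (ℕ → Fin N → ℝ) → ℕ → Fin N → ℝ := fun w i => w (i + 1)
  have hS := h.2.toMeasurePreserving.iterate i
  have h0 : Measurable fun w : ℕ → Fin N → ℝ => w 0 := measurable_pi_apply 0
  have h1 : ℙ.map (g i) = ((ℙ.map fun ω i => g i ω).map S^[i]).map fun w => w 0 := by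
    rw [Measure.map_map h0 hS.measurable, Measure.map_map (h0.comp hS.measurable) h.measurable_path]
    congr 1
    ext1 ω
    exact (iterate_shift_apply_zero i fun i => g i ω).symm
  rw [h1, hS.map_eq, Measure.map_map h0 h.measurable_path]
  rfl

theorem StationaryErgodic.ae_all (h : StationaryErgodic ℙ g) {p : (Fin N → ℝ) → Prop}
    (hp : MeasurableSet {v | p v}) (h0 : ∀ᵐ ω ∂ℙ, p (g 0 ω)) : ∀ᵐ ω ∂ℙ, ∀ i, p (g i ω) := by
  refine ae_all_iff.2 fun i => ?_
  rw [← ae_map_iff (h.1 i).aemeasurable hp, h.map_eq i, ae_map_iff (h.1 0).aemeasurable hp]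
  exact h0

/-- Birkhoff's theorem is applied to the shift on path space and the function `w ↦ f (w 0)`, then
pulled back along the path map. -/
theorem StationaryErgodic.ae_tendsto_avg [IsProbabilityMeasure ℙ] (h : StationaryErgodic ℙ g)
    {f : (Fin N → ℝ) → ℝ} (hfm : Measurable f) (hf : Integrable (fun ω => f (g 0 ω)) ℙ) :
    ∀ᵐ ω ∂ℙ, Tendsto (avg fun i => f (g i ω)) atTop (𝓝 (∫ ω, f (g 0 ω) ∂ℙ)) := by
  have hG := h.measurable_path
  have h0 : Measurable fun w : ℕ → Fin N → ℝ => w 0 := measurable_pi_apply 0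
  have : IsProbabilityMeasure (ℙ.map fun ω i => g i ω) :=
    Measure.isProbabilityMeasure_map hG.aemeasurable
  have hF : Measurable fun w : ℕ → Fin N → ℝ => f (w 0) := hfm.comp h0
  have key := Birkhoff.ae_tendsto_birkhoffSum_div h.2 hF
    ((integrable_map_measure hF.aestronglyMeasurable hG.aemeasurable).2 hf)
  rw [integral_map hG.aemeasurable hF.aestronglyMeasurable] at key
  filter_upwards [ae_of_ae_map hG.aemeasurable key] with ω hω
  refine hω.congr fun n => ?_
  unfold avg birkhoffSum
  congr 1
  refine Finset.sum_congr rfl fun i _ => ?_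
  exact congrArg f (iterate_shift_apply_zero i fun i => g i ω)

/-! ### The levels of received power that are assigned to a user

At level `t = 1 + z` the net marginal value of user `n` is `μ n / t - c n`, where
`c n = lam n / g n` is the price of received power. -/

/-- The levels at which user `n` has the largest net marginal value, and a positive one. -/
def winSet (μ c : Fin N → ℝ) (n : Fin N) : Set ℝ :=
  {t | 1 < t ∧ 0 < μ n / t - c n ∧ ∀ k, k ≠ n → μ k / t - c k < μ n / t - c n}

/-- The levels at which two users may have the same net marginal value. -/
def tieSet (μ c : Fin N → ℝ) : Set ℝ :=
  Set.range fun p : Fin N × Fin N => (μ p.1 - μ p.2) / (c p.1 - c p.2)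

/-- The largest net marginal value (outside the ties), when it is positive, and `0` otherwise. -/
noncomputable def envelope (μ c : Fin N → ℝ) (t : ℝ) : ℝ :=
  ∑ n, (winSet μ c n).indicator (fun t => μ n / t - c n) t

/-- The maximal net value of received power. -/
noncomputable def netValue (μ c : Fin N → ℝ) : ℝ := ∫ t in Set.Ioi 1, envelope μ c t

section Levels

variable {μ c : Fin N → ℝ}

theorem tieSet_finite (μ c : Fin N → ℝ) : (tieSet μ c).Finite := Set.finite_range _

/-- Openness turns "wins some level" into "wins a set of levels of positive length", hence a
transmitting user into one with positive power. -/
theorem isOpen_winSet (μ c : Fin N → ℝ) (n : Fin N) : IsOpen (winSet μ c n) := by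
  have hφ : ∀ k, ContinuousOn (fun t : ℝ => μ k / t - c k) (Set.Ioi 1) := fun k =>
    (continuousOn_const.div continuousOn_id fun t ht => (zero_lt_one.trans ht).ne').sub
      continuousOn_const
  have : winSet μ c n = {t | t ∈ Set.Ioi (1 : ℝ) ∧ ∀ k : Fin N,
      t ∈ Set.Ioi (1 : ℝ) ∩ (fun t => ((μ n / t - c n), (μ n / t - c n) - (μ k / t - c k))) ⁻¹'
        {p | 0 < p.1 ∧ (k ≠ n → 0 < p.2)}} := by
    ext t
    simp only [winSet, Set.mem_ofPred_eq, Set.mem_inter_iff, Set.mem_preimage, sub_pos,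
      Set.mem_Ioi]
    exact ⟨fun h => ⟨h.1, fun k => ⟨h.1, h.2.1, h.2.2 k⟩⟩,
      fun h => ⟨h.1, by simpa using (h.2 n).2.1, fun k => (h.2 k).2.2⟩⟩
  rw [this, Set.ofPred_and, Set.ofPred_forall]
  refine isOpen_Ioi.inter (isOpen_iInter_of_finite fun k => ?_)
  refine ((hφ n).prodMk ((hφ n).sub (hφ k))).isOpen_inter_preimage isOpen_Ioi ?_
  by_cases h : k = n
  · simpa [h] using isOpen_lt continuous_const continuous_fst
  · simpa [h] using (isOpen_lt continuous_const continuous_fst).and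
      (isOpen_lt continuous_const continuous_snd)

theorem measurableSet_winSet (μ c : Fin N → ℝ) (n : Fin N) : MeasurableSet (winSet μ c n) :=
  (isOpen_winSet μ c n).measurableSet

theorem winSet_subset (hc : ∀ n, 0 < c n) (n : Fin N) :
    winSet μ c n ⊆ Set.Ioo 1 (μ n / c n) := by
  intro t ht
  have h0 : (0 : ℝ) < t := zero_lt_one.trans ht.1
  have h1 := ht.2.1
  rw [sub_pos, lt_div_iff₀ h0] at h1
  exact ⟨ht.1, by rw [lt_div_iff₀ (hc n)]; linarith⟩

theorem volume_winSet_ne_top (hc : ∀ n, 0 < c n) (n : Fin N) : volume (winSet μ c n) ≠ ⊤ :=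
  ((measure_mono (winSet_subset hc n)).trans_lt measure_Ioo_lt_top).ne

theorem eq_of_mem_winSet {j k : Fin N} {t : ℝ} (hj : t ∈ winSet μ c j) (hk : t ∈ winSet μ c k) :
    j = k := by
  by_contra h
  exact (lt_trans (hj.2.2 k (Ne.symm h)) (hk.2.2 j h)).false

/-- The advantage `(μ j - μ k) / t` of the user with the larger weight shrinks as the level rises
while the price difference stays fixed, so once `k` has overtaken `j` it stays ahead. The winners
thus appear in the order of the stack. -/
theorem lt_of_mem_winSet (hμ : Antitone μ) {j k : Fin N} (hjk : j < k) {t u : ℝ}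
    (ht : t ∈ winSet μ c j) (hu : u ∈ winSet μ c k) : t < u := by
  by_contra! h
  have hu0 : (0 : ℝ) < u := zero_lt_one.trans hu.1
  have h1 := ht.2.2 k hjk.ne'
  have h2 := hu.2.2 j hjk.ne
  have h3 : (μ j - μ k) / t ≤ (μ j - μ k) / u :=
    div_le_div_of_nonneg_left (sub_nonneg.2 (hμ hjk.le)) hu0 h
  rw [sub_div, sub_div] at h3
  linarith

theorem le_of_mem_winSet (hμ : Antitone μ) {j k : Fin N} {t u : ℝ}
    (ht : t ∈ winSet μ c j) (hu : u ∈ winSet μ c k) (htu : t ≤ u) : j ≤ k := by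
  by_contra! h
  exact (lt_of_mem_winSet hμ h hu ht).not_ge htu

/-- A user with the largest marginal can fail to be the strict winner only at a crossing point;
distinct prices give each pair of users at most one. The diagonal pairs in `tieSet` contribute only
`0 / 0 = 0`, which lies outside the levels above 1. -/
theorem exists_mem_winSet_or (hci : Function.Injective c) {t : ℝ} (ht : 1 < t)
    (htie : t ∉ tieSet μ c) : (∃ n, t ∈ winSet μ c n) ∨ ∀ n, μ n / t - c n ≤ 0 := by
  rcases isEmpty_or_nonempty (Fin N) with hN | hN
  · exact Or.inr fun n => hN.elim n
  obtain ⟨n, hn⟩ := Finite.exists_max fun n => μ n / t - c n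
  rcases le_or_gt (μ n / t - c n) 0 with h | h
  · exact Or.inr fun k => (hn k).trans h
  · refine Or.inl ⟨n, ht, h, fun k hk => (hn k).lt_of_ne fun he => htie ⟨(k, n), ?_⟩⟩
    have h0 : t ≠ 0 := (zero_lt_one.trans ht).ne'
    have h1 : c k - c n ≠ 0 := sub_ne_zero.2 fun h => hk (hci h)
    simp only
    rw [div_eq_iff h1]
    have h2 : (μ k - μ n) / t = c k - c n := by rw [sub_div]; linarith
    rw [div_eq_iff h0] at h2
    linarith

theorem envelope_eq_of_mem {n : Fin N} {t : ℝ} (h : t ∈ winSet μ c n) :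
    envelope μ c t = μ n / t - c n := by
  unfold envelope
  rw [Finset.sum_eq_single n, Set.indicator_of_mem h]
  · intro k _ hk
    exact Set.indicator_of_notMem (fun hk' => hk (eq_of_mem_winSet hk' h)) _
  · simp

theorem envelope_nonneg (μ c : Fin N → ℝ) (t : ℝ) : 0 ≤ envelope μ c t :=
  Finset.sum_nonneg fun _ _ => Set.indicator_nonneg (fun _ ht => ht.2.1.le) _

theorem le_envelope (hci : Function.Injective c) {t : ℝ} (ht : 1 < t) (htie : t ∉ tieSet μ c)
    (n : Fin N) : μ n / t - c n ≤ envelope μ c t := by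
  rcases exists_mem_winSet_or hci ht htie with ⟨m, hm⟩ | h
  · rw [envelope_eq_of_mem hm]
    rcases eq_or_ne n m with rfl | hne
    · exact le_rfl
    · exact (hm.2.2 n hne).le
  · exact (h n).trans (envelope_nonneg _ _ _)

theorem ae_le_envelope (hci : Function.Injective c) (n : Fin N) :
    ∀ᵐ t : ℝ, 1 < t → μ n / t - c n ≤ envelope μ c t := by
  have h : ∀ᵐ t : ℝ, t ∉ tieSet μ c := 
    measure_eq_zero_iff_ae_notMem.1 ((tieSet_finite μ c).measure_zero volume)
  filter_upwards [h] with t ht h1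
  exact le_envelope hci h1 ht n

theorem integrableOn_marginal (a b : ℝ) {l u : ℝ} (hl : 1 ≤ l) :
    IntegrableOn (fun t : ℝ => a / t - b) (Set.Ioc l u) := by
  refine (ContinuousOn.integrableOn_Icc ?_).mono_set Set.Ioc_subset_Icc_self
  exact (continuousOn_const.div continuousOn_id fun t ht =>
    (zero_lt_one.trans_le (hl.trans ht.1)).ne').sub continuousOn_const

theorem integrableOn_winSet (hc : ∀ n, 0 < c n) (n : Fin N) :
    IntegrableOn (fun t : ℝ => μ n / t - c n) (winSet μ c n) :=
  (integrableOn_marginal (μ n) (c n) le_rfl).mono_set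
    ((winSet_subset hc n).trans Set.Ioo_subset_Ioc_self)

theorem integrable_envelope (hc : ∀ n, 0 < c n) : Integrable (envelope μ c) :=
  integrable_finsetSum _ fun n _ =>
    (integrable_indicator_iff (measurableSet_winSet μ c n)).2 (integrableOn_winSet hc n)

theorem netValue_eq_sum (hc : ∀ n, 0 < c n) :
    netValue μ c = ∑ n, ∫ t in winSet μ c n, (μ n / t - c n) := by
  unfold netValue envelope
  rw [integral_finsetSum]
  · refine Finset.sum_congr rfl fun n _ => ?_
    rw [setIntegral_indicator (measurableSet_winSet μ c n)]
    congr 2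
    exact Set.inter_eq_right.2 fun t ht => ht.1
  · intro n _
    exact ((integrable_indicator_iff (measurableSet_winSet μ c n)).2
      (integrableOn_winSet hc n)).integrableOn

/-! ### Received powers stacked in the order of decoding -/

/-- `1` plus the received power of the users before `m`. -/
noncomputable def stack (v : Fin N → ℝ) (m : ℕ) : ℝ :=
  1 + ∑ k ∈ Finset.univ.filter (fun k : Fin N => (k : ℕ) < m), v k

theorem stack_succ (v : Fin N → ℝ) (n : Fin N) : stack v (n + 1) = stack v n + v n := by
  unfold stack
  have : (Finset.univ.filter fun k : Fin N => (k : ℕ) < n + 1)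
      = insert n (Finset.univ.filter fun k : Fin N => (k : ℕ) < n) := by
    ext k
    simp only [Finset.mem_filter, Finset.mem_univ, true_and, Finset.mem_insert, Fin.ext_iff]
    omega
  rw [this, Finset.sum_insert (by simp)]
  ring

theorem stack_zero (v : Fin N → ℝ) : stack v 0 = 1 := by simp [stack]

theorem one_le_stack {v : Fin N → ℝ} (hv : ∀ n, 0 ≤ v n) (m : ℕ) : 1 ≤ stack v m := by
  have : 0 ≤ ∑ k ∈ Finset.univ.filter (fun k : Fin N => (k : ℕ) < m), v k :=
    Finset.sum_nonneg fun k _ => hv k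
  unfold stack
  linarith

theorem stack_le_succ {v : Fin N → ℝ} (hv : ∀ n, 0 ≤ v n) (n : Fin N) :
    stack v n ≤ stack v (n + 1) := by
  rw [stack_succ]; linarith [hv n]

theorem sum_stack_telescope (h : ℝ → ℝ) (v : Fin N → ℝ) :
    ∑ n : Fin N, (h (stack v (n + 1)) - h (stack v n)) = h (stack v N) - h 1 := by
  rw [Fin.sum_univ_eq_sum_range fun n => h (stack v (n + 1)) - h (stack v n),
    Finset.sum_range_sub fun n => h (stack v n), stack_zero]

/-- With `l` and `u` the stack before and after a user, the right side is the net value of that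
user: rates become integrals over levels. -/
theorem integral_marginal (a b : ℝ) {l u : ℝ} (hl : 1 ≤ l) (hlu : l ≤ u) :
    ∫ t in Set.Ioc l u, (a / t - b) = a * Real.log (u / l) - b * (u - l) := by
  have hl0 : 0 < l := zero_lt_one.trans_le hl
  have hmem : (0 : ℝ) ∉ Set.uIcc l u := by
    rw [Set.uIcc_of_le hlu]; exact fun h => hl0.not_ge h.1
  rw [← intervalIntegral.integral_of_le hlu, intervalIntegral.integral_sub]
  · simp_rw [div_eq_mul_inv]
    rw [intervalIntegral.integral_const_mul, integral_inv hmem, intervalIntegral.integral_const,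
      smul_eq_mul, div_eq_mul_inv]
    ring
  · exact (intervalIntegral.intervalIntegrable_inv (fun t ht h0 => hmem (h0 ▸ ht))
      continuousOn_id).const_mul a |>.congr (fun t _ => by simp [div_eq_mul_inv])
  · exact intervalIntegrable_const

/-- No choice of received powers has a net value above `netValue`. -/
theorem sum_le_netValue (hc : ∀ n, 0 < c n) (hci : Function.Injective c) {v : Fin N → ℝ}
    (hv : ∀ n, 0 ≤ v n) :
    ∑ n : Fin N, (μ n * Real.log (stack v (n + 1) / stack v n) - c n * v n) ≤ netValue μ c := by
  have hint := integrable_envelope (μ := μ) hc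
  -- Each user's own marginal is at most the envelope on the interval that it occupies. The
  -- intervals tile the levels from 1 to `stack v N`, so the bounds telescope, and the levels above
  -- only add to the envelope's integral.
  have hstep : ∀ n : Fin N, μ n * Real.log (stack v (n + 1) / stack v n) - c n * v n ≤
      (∫ t in (1 : ℝ)..stack v (n + 1), envelope μ c t)
        - ∫ t in (1 : ℝ)..stack v n, envelope μ c t := by
    intro n
    have h1 := one_le_stack hv n
    have h2 := stack_le_succ hv n
    have h3 := integral_marginal (μ n) (c n) h1 h2
    rw [stack_succ, add_sub_cancel_left, ← stack_succ] at h3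
    rw [← h3, intervalIntegral.integral_interval_sub_left hint.intervalIntegrable
      hint.intervalIntegrable, intervalIntegral.integral_of_le h2]
    refine setIntegral_mono_on_ae (integrableOn_marginal _ _ h1) hint.integrableOn
      measurableSet_Ioc ?_
    filter_upwards [ae_le_envelope hci n] with t ht hmem
    exact ht (h1.trans_lt hmem.1)
  refine (Finset.sum_le_sum fun n _ => hstep n).trans ?_
  rw [sum_stack_telescope fun u => ∫ t in (1 : ℝ)..u, envelope μ c t,
    intervalIntegral.integral_same, sub_zero,
    intervalIntegral.integral_of_le (one_le_stack hv N)]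
  exact setIntegral_mono_set hint.integrableOn
    (Eventually.of_forall fun t => envelope_nonneg μ c t)
    (LE.le.eventuallyLE Set.Ioc_subset_Ioi_self)

/-- Such a set fills everything from 1 to its supremum except finitely many points, so its length
determines the supremum. -/
theorem ae_eq_Ioc_of_initial {A T : Set ℝ} {b : ℝ} (hA : A ⊆ Set.Ioo 1 b) (hT : T.Finite)
    (h : ∀ t ∈ A, ∀ s, 1 < s → s < t → s ∉ T → s ∈ A) :
    A =ᵐ[volume] Set.Ioc 1 (1 + volume.real A) := by
  rcases A.eq_empty_or_nonempty with rfl | hne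
  · simp
  have hbdd : BddAbove A := ⟨b, fun t ht => (hA ht).2.le⟩
  have h1 : A ⊆ Set.Ioc 1 (sSup A) := fun t ht => ⟨(hA ht).1, le_csSup hbdd ht⟩
  have h2 : Set.Ioo 1 (sSup A) \ T ⊆ A := by
    rintro s ⟨⟨hs1, hs2⟩, hsT⟩
    obtain ⟨t, ht, hst⟩ := exists_lt_of_lt_csSup hne hs2
    exact h t ht s hs1 hst hsT
  have h3 : A =ᵐ[volume] Set.Ioc 1 (sSup A) := by
    refine EventuallyLE.antisymm h1.eventuallyLE ?_
    have h4 : Set.Ioc 1 (sSup A) =ᵐ[volume] Set.Ioo 1 (sSup A) := Ioo_ae_eq_Ioc.symm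
    have h5 : (Set.Ioo 1 (sSup A) \ T : Set ℝ) =ᵐ[volume] Set.Ioo 1 (sSup A) :=
      sdiff_null_ae_eq_self (hT.measure_zero volume)
    exact (h4.trans h5.symm).le.trans h2.eventuallyLE
  obtain ⟨t, ht⟩ := hne
  have h6 : volume.real A = sSup A - 1 := by
    rw [measureReal_congr h3, Real.volume_real_Ioc_of_le ((h1 ht).1.le.trans (h1 ht).2)]
  rw [h6, add_sub_cancel]
  exact h3

/-- The users before `m` together win an initial segment of the levels. -/
theorem iUnion_winSet_ae_eq (hμ : Antitone μ) (hc : ∀ n, 0 < c n) (hci : Function.Injective c)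
    (m : ℕ) :
    (⋃ k ∈ Finset.univ.filter (fun k : Fin N => (k : ℕ) < m), winSet μ c k) =ᵐ[volume]
      Set.Ioc 1 (stack (fun n => volume.real (winSet μ c n)) m) := by
  have hmeas : volume.real (⋃ k ∈ Finset.univ.filter (fun k : Fin N => (k : ℕ) < m), winSet μ c k)
      = ∑ k ∈ Finset.univ.filter (fun k : Fin N => (k : ℕ) < m), volume.real (winSet μ c k) := by
    refine measureReal_biUnion_finset ?_ (fun k _ => measurableSet_winSet μ c k)
      fun k _ => volume_winSet_ne_top hc k
    intro j _ k _ hjk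
    exact Set.disjoint_left.2 fun t hj hk => hjk (eq_of_mem_winSet hj hk)
  unfold stack
  rw [← hmeas]
  refine ae_eq_Ioc_of_initial (b := ∑ k, |μ k / c k|) ?_ (tieSet_finite μ c) ?_
  · refine Set.iUnion₂_subset fun k _ => (winSet_subset hc k).trans
      (Set.Ioo_subset_Ioo_right ((le_abs_self _).trans ?_))
    exact Finset.single_le_sum (f := fun k => |μ k / c k|) (fun _ _ => abs_nonneg _)
      (Finset.mem_univ k)
  · intro t ht s hs1 hst hsT
    simp only [Finset.mem_filter, Finset.mem_univ, true_and, Set.mem_iUnion, exists_prop] at ht ⊢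
    obtain ⟨k, hkm, hk⟩ := ht
    -- The marginal of `k` is positive at `t` and larger still at the lower level `s`, so some user
    -- wins at `s`; by the order of the winners it does not come after `k`.
    rcases exists_mem_winSet_or hci hs1 hsT with ⟨j, hj⟩ | h
    · exact ⟨j, (Fin.le_def.1 (le_of_mem_winSet hμ hj hk hst.le)).trans_lt hkm, hj⟩
    · exfalso
      have h1 := h k
      have h2 := winSet_subset hc k hk
      rw [sub_nonpos, div_le_iff₀ (zero_lt_one.trans hs1)] at h1
      have h3 := h2.2
      rw [lt_div_iff₀ (hc k)] at h3
      nlinarith [hc k]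

/-- The levels of `n` are the difference of two consecutive initial segments; this places each
winning set exactly where its length puts the user in the stack. -/
theorem winSet_ae_eq (hμ : Antitone μ) (hc : ∀ n, 0 < c n) (hci : Function.Injective c)
    (n : Fin N) :
    winSet μ c n =ᵐ[volume] Set.Ioc (stack (fun n => volume.real (winSet μ c n)) n)
      (stack (fun n => volume.real (winSet μ c n)) (n + 1)) := by
  have h1 := (iUnion_winSet_ae_eq hμ hc hci (n + 1)).diff (iUnion_winSet_ae_eq hμ hc hci n)
  have h2 : (⋃ k ∈ Finset.univ.filter (fun k : Fin N => (k : ℕ) < n + 1), winSet μ c k) \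
      (⋃ k ∈ Finset.univ.filter (fun k : Fin N => (k : ℕ) < n), winSet μ c k) = winSet μ c n := by
    ext t
    simp only [Finset.mem_filter, Finset.mem_univ, true_and, Set.mem_sdiff, Set.mem_iUnion,
      exists_prop, not_exists, not_and]
    constructor
    · rintro ⟨⟨k, hk, h⟩, h2⟩
      rcases (Nat.lt_succ_iff.1 hk).lt_or_eq with h3 | h3
      · exact absurd h (h2 k h3)
      · rwa [Fin.ext h3] at h
    · exact fun h => ⟨⟨n, Nat.lt_succ_self _, h⟩,
        fun k hk h' => (Fin.lt_def.2 hk).ne (eq_of_mem_winSet h' h)⟩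
  rw [h2] at h1
  refine h1.trans (EventuallyEq.of_eq (Set.ext fun t => ?_))
  have := one_le_stack (v := fun n => volume.real (winSet μ c n)) (fun n => measureReal_nonneg) n
  simp only [Set.mem_Ioc, Set.mem_sdiff, not_and, not_le]
  exact ⟨fun h => ⟨h.2 h.1.1, h.1.2⟩, fun h => ⟨⟨this.trans_lt h.1, h.2⟩, fun _ => h.1⟩⟩

/-- The received powers given by the sizes of the winning sets attain `netValue`. -/
theorem sum_eq_netValue (hμ : Antitone μ) (hc : ∀ n, 0 < c n) (hci : Function.Injective c) :
    ∑ n : Fin N, (μ n * Real.log (stack (fun n => volume.real (winSet μ c n)) (n + 1)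
      / stack (fun n => volume.real (winSet μ c n)) n) - c n * volume.real (winSet μ c n))
      = netValue μ c := by
  rw [netValue_eq_sum hc]
  refine Finset.sum_congr rfl fun n _ => ?_
  have hv : ∀ n, 0 ≤ volume.real (winSet μ c n) := fun n => measureReal_nonneg
  rw [setIntegral_congr_set (winSet_ae_eq hμ hc hci n),
    integral_marginal _ _ (one_le_stack hv n) (stack_le_succ hv n), stack_succ,
    add_sub_cancel_left]

end Levels

/-! ### The proposed powers as sizes of sets of levels -/

/-- Positive gains at which no two users have the same price of received power. -/
def GoodGain (lam g : Fin N → ℝ) : Prop :=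
  (∀ n, 0 < g n) ∧ Function.Injective fun n => lam n / g n

/-- The transmit power that gives user `n` the levels that it wins. -/
noncomputable def power (μ lam g : Fin N → ℝ) (n : Fin N) : ℝ :=
  volume.real (winSet μ (fun k => lam k / g k) n) / g n

/-- Weighted sum of the rates (in nats), less the price of the transmit powers. -/
noncomputable def lagrangian (μ lam g P : Fin N → ℝ) : ℝ :=
  ∑ n, (μ n * (Real.log 2 * rate g P n) - lam n * P n)

section Powers

variable {μ lam g : Fin N → ℝ}

theorem GoodGain.price_pos (h : GoodGain lam g) (hlam : ∀ n, 0 < lam n) (n : Fin N) :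
    0 < lam n / g n := div_pos (hlam n) (h.1 n)

/-- The two sides differ at `z = 0`, since `winSet` requires a level strictly above 1. The winning
conditions are strict and continuous, so a witness can be moved slightly to the right. -/
theorem mem_activeSet_iff (n : Fin N) :
    n ∈ activeSet μ lam g ↔ (winSet μ (fun k => lam k / g k) n).Nonempty := by
  constructor
  · rintro ⟨z, hz, hpos, hwin⟩
    have hz1 : (1 + z) ≠ 0 := by positivity
    have hcont : ∀ k, ContinuousAt (fun t : ℝ => μ k / t - lam k / g k) (1 + z) := fun k =>
      (continuousAt_const.div continuousAt_id hz1).sub continuousAt_const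
    have h1 : ∀ᶠ t in 𝓝 (1 + z), 0 < μ n / t - lam n / g n :=
      (hcont n).eventually (lt_mem_nhds hpos)
    have h2 : ∀ k, ∀ᶠ t in 𝓝 (1 + z), k ≠ n → μ k / t - lam k / g k < μ n / t - lam n / g n := by
      intro k
      by_cases hk : k = n
      · exact Eventually.of_forall fun t h => absurd hk h
      · filter_upwards [(hcont k).eventually_lt (hcont n) (hwin k hk)] with t ht _ using ht
    have h3 : ∀ᶠ t in 𝓝[>] (1 + z), t ∈ winSet μ (fun k => lam k / g k) n := by
      filter_upwards [self_mem_nhdsWithin, nhdsWithin_le_nhds h1,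
        nhdsWithin_le_nhds (eventually_all.2 h2)] with t ht0 ht1 ht2
      exact ⟨lt_of_le_of_lt (by linarith) ht0, ht1, ht2⟩
    exact h3.exists
  · rintro ⟨t, ht⟩
    refine ⟨t - 1, by linarith [ht.1], ?_⟩
    rw [add_sub_cancel]
    exact ⟨ht.2.1, ht.2.2⟩

theorem volume_real_winSet_pos {c : Fin N → ℝ} (hc : ∀ n, 0 < c n) {n : Fin N}
    (h : (winSet μ c n).Nonempty) : 0 < volume.real (winSet μ c n) :=
  ENNReal.toReal_pos ((isOpen_winSet μ c n).measure_pos volume h).ne' (volume_winSet_ne_top hc n)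

/-- A user with no larger weight can lead only by a lower price. This fixes the sign of the
denominators in the power formula. -/
theorem price_lt_of_mem_winSet {c : Fin N → ℝ} (hμ : Antitone μ) {j k : Fin N} (hjk : j < k)
    {u : ℝ} (hu : u ∈ winSet μ c k) : c k < c j := by
  have h1 := hu.2.2 j hjk.ne
  have h2 : μ k / u ≤ μ j / u := div_le_div_of_nonneg_right (hμ hjk.le) (zero_lt_one.trans hu.1).le
  linarith

theorem lt_crossing_iff {c : Fin N → ℝ} {j k : Fin N} (h : c k < c j) {t : ℝ} (ht : 0 < t) :
    t < (μ j - μ k) / (c j - c k) ↔ μ k / t - c k < μ j / t - c j := by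
  rw [lt_div_iff₀ (sub_pos.2 h), ← lt_div_iff₀' ht, sub_div]
  constructor <;> intro h <;> linarith

theorem crossing_lt_iff {c : Fin N → ℝ} {j k : Fin N} (h : c k < c j) {t : ℝ} (ht : 0 < t) :
    (μ j - μ k) / (c j - c k) < t ↔ μ j / t - c j < μ k / t - c k := by
  rw [div_lt_iff₀ (sub_pos.2 h), ← div_lt_iff₀' ht, sub_div]
  constructor <;> intro h <;> linarith

/-- In units of received power the upper term is the level at which the next transmitting user `m`
overtakes `n`, or the zero of the marginal of `n` if there is no such `m`. In the first case, below
that level `m` loses to `n`, users after `m` win only above the levels of `m`, and some marginal is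
positive; so the winner is at most `n`. -/
theorem upperTerm_spec (hμ : Antitone μ) (hlam : ∀ n, 0 < lam n) (hg : GoodGain lam g)
    (n : Fin N) :
    (∀ t ∈ winSet μ (fun k => lam k / g k) n,
      t < g n * upperTerm μ lam g (activeSet μ lam g) n) ∧
    ∀ t, 1 < t → t ∉ tieSet μ (fun k => lam k / g k) →
      t < g n * upperTerm μ lam g (activeSet μ lam g) n →
      ∃ j ≤ n, t ∈ winSet μ (fun k => lam k / g k) j := by
  classical
  set c : Fin N → ℝ := fun k => lam k / g k with hcdef
  have hc : ∀ n, 0 < c n := hg.price_pos hlam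
  unfold upperTerm
  split_ifs with hne
  · set m := (Finset.univ.filter fun k => k ∈ activeSet μ lam g ∧ n < k).min' hne with hm
    have hmem : m ∈ Finset.univ.filter fun k => k ∈ activeSet μ lam g ∧ n < k :=
      Finset.min'_mem _ hne
    simp only [Finset.mem_filter, Finset.mem_univ, true_and] at hmem
    obtain ⟨hmJ, hnm⟩ := hmem
    obtain ⟨s, hs⟩ := (mem_activeSet_iff m).1 hmJ
    have hlt : c m < c n := price_lt_of_mem_winSet hμ hnm hs
    have hV : g n * ((μ n - μ m) / (lam n - lam m * g n / g m)) = (μ n - μ m) / (c n - c m) := by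
      have h1 : lam n - lam m * g n / g m = g n * (c n - c m) := by
        have := (hg.1 n).ne'
        simp only [hcdef]
        field_simp
      rw [h1, ← mul_div_assoc, mul_div_mul_left _ _ (hg.1 n).ne']
    simp only []
    rw [hV]
    refine ⟨fun t ht => (lt_crossing_iff hlt (zero_lt_one.trans ht.1)).2 (ht.2.2 m hnm.ne'), ?_⟩
    intro t ht1 htie htV
    have ht0 : 0 < t := zero_lt_one.trans ht1
    have hs0 : 0 < s := zero_lt_one.trans hs.1
    have hts : t < s := htV.trans ((crossing_lt_iff hlt hs0).2 (hs.2.2 n hnm.ne))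
    rw [lt_crossing_iff hlt ht0] at htV
    rcases exists_mem_winSet_or hg.2 ht1 htie with ⟨j, hj⟩ | h
    · refine ⟨j, ?_, hj⟩
      by_contra! hnj
      have hmj : m ≤ j := Finset.min'_le _ _ (by
        simpa using ⟨(mem_activeSet_iff j).2 ⟨t, hj⟩, hnj⟩)
      rcases hmj.eq_or_lt with h1 | h1
      · rw [← h1] at hj
        exact lt_asymm htV (hj.2.2 n hnm.ne)
      · exact lt_asymm hts (lt_of_mem_winSet hμ h1 hs hj)
    · exfalso
      have h1 := h m
      have h2 := (winSet_subset hc m hs).2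
      rw [lt_div_iff₀ (hc m)] at h2
      rw [sub_nonpos, div_le_iff₀ ht0] at h1
      have h3 : c m * t < c m * s := mul_lt_mul_of_pos_left hts (hc m)
      change μ m ≤ c m * t at h1
      linarith
  · have hV : g n * (μ n / lam n) = μ n / c n := by
      simp only [hcdef]
      field_simp
    rw [hV]
    refine ⟨fun t ht => (winSet_subset hc n ht).2, ?_⟩
    intro t ht1 htie htV
    have ht0 : 0 < t := zero_lt_one.trans ht1
    rcases exists_mem_winSet_or hg.2 ht1 htie with ⟨j, hj⟩ | h
    · refine ⟨j, ?_, hj⟩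
      by_contra! hnj
      exact hne ⟨j, by simpa using ⟨(mem_activeSet_iff j).2 ⟨t, hj⟩, hnj⟩⟩
    · exfalso
      have h1 := h n
      rw [lt_div_iff₀ (hc n)] at htV
      rw [sub_nonpos, div_le_iff₀ ht0] at h1
      change μ n ≤ c n * t at h1
      linarith

/-- The mirror image: the lower term is the level at which `n` overtakes the preceding transmitting
user, or the noise level 1 if there is none. Above it no earlier user wins. -/
theorem lowerTerm_spec (hμ : Antitone μ) (hg : GoodGain lam g)
    {n : Fin N} (hn : n ∈ activeSet μ lam g) :
    1 ≤ g n * lowerTerm μ lam g (activeSet μ lam g) n ∧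
    (∀ t ∈ winSet μ (fun k => lam k / g k) n,
      g n * lowerTerm μ lam g (activeSet μ lam g) n < t) ∧
    ∀ j, ∀ t ∈ winSet μ (fun k => lam k / g k) j,
      g n * lowerTerm μ lam g (activeSet μ lam g) n < t → n ≤ j := by
  classical
  set c : Fin N → ℝ := fun k => lam k / g k with hcdef
  obtain ⟨u, hu⟩ := (mem_activeSet_iff n).1 hn
  unfold lowerTerm
  split_ifs with hne
  · set m := (Finset.univ.filter fun k => k ∈ activeSet μ lam g ∧ k < n).max' hne with hm
    have hmem : m ∈ Finset.univ.filter fun k => k ∈ activeSet μ lam g ∧ k < n :=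
      Finset.max'_mem _ hne
    simp only [Finset.mem_filter, Finset.mem_univ, true_and] at hmem
    obtain ⟨hmJ, hmn⟩ := hmem
    obtain ⟨s, hs⟩ := (mem_activeSet_iff m).1 hmJ
    have hlt : c n < c m := price_lt_of_mem_winSet hμ hmn hu
    have hL : g n * ((μ m - μ n) / (-lam n + lam m * g n / g m)) = (μ m - μ n) / (c m - c n) := by
      have h1 : -lam n + lam m * g n / g m = g n * (c m - c n) := by
        have := (hg.1 n).ne'
        simp only [hcdef]
        field_simp
        ring
      rw [h1, ← mul_div_assoc, mul_div_mul_left _ _ (hg.1 n).ne']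
    simp only []
    rw [hL]
    have hsL : s < (μ m - μ n) / (c m - c n) :=
      (lt_crossing_iff hlt (zero_lt_one.trans hs.1)).2 (hs.2.2 n hmn.ne')
    refine ⟨(hs.1.trans hsL).le,
      fun t ht => (crossing_lt_iff hlt (zero_lt_one.trans ht.1)).2 (ht.2.2 m hmn.ne), ?_⟩
    intro j t hj htL
    by_contra! hjn
    have hjm : j ≤ m := Finset.le_max' _ _ (by
      simpa using ⟨(mem_activeSet_iff j).2 ⟨t, hj⟩, hjn⟩)
    rcases hjm.eq_or_lt with h1 | h1
    · rw [h1] at hj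
      exact lt_asymm ((crossing_lt_iff hlt (zero_lt_one.trans hj.1)).1 htL) (hj.2.2 n hmn.ne')
    · exact lt_asymm (htL.trans (lt_of_mem_winSet hμ h1 hj hs)) hsL
  · have hL : g n * (1 / g n) = 1 := mul_one_div_cancel (hg.1 n).ne'
    rw [hL]
    refine ⟨le_rfl, fun t ht => ht.1, ?_⟩
    intro j t hj _
    by_contra! hjn
    exact hne ⟨j, by simpa using ⟨(mem_activeSet_iff j).2 ⟨t, hj⟩, hjn⟩⟩

theorem winSet_ae_eq_Ioo (hμ : Antitone μ) (hlam : ∀ n, 0 < lam n) (hg : GoodGain lam g)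
    {n : Fin N} (hn : n ∈ activeSet μ lam g) :
    winSet μ (fun k => lam k / g k) n =ᵐ[volume]
      Set.Ioo (g n * lowerTerm μ lam g (activeSet μ lam g) n)
        (g n * upperTerm μ lam g (activeSet μ lam g) n) := by
  obtain ⟨hU1, hU2⟩ := upperTerm_spec hμ hlam hg n
  obtain ⟨hL0, hL1, hL2⟩ := lowerTerm_spec hμ hg hn
  have htie : ∀ᵐ t : ℝ, t ∉ tieSet μ (fun k => lam k / g k) :=
    measure_eq_zero_iff_ae_notMem.1 ((tieSet_finite _ _).measure_zero volume)
  rw [eventuallyEq_set]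
  filter_upwards [htie] with t ht
  refine ⟨fun h => ⟨hL1 t h, hU1 t h⟩, fun h => ?_⟩
  obtain ⟨j, hjn, hj⟩ := hU2 t (hL0.trans_lt h.1) ht h.2
  rwa [hjn.antisymm (hL2 j t hj h.1)] at hj

/-- The explicit formula for the powers gives every user exactly the levels that it wins. -/
theorem ehuPower_eq_power (hμ : Antitone μ) (hlam : ∀ n, 0 < lam n) (hg : GoodGain lam g) :
    ehuPower μ lam g = power μ lam g := by
  funext n
  unfold ehuPower power
  split_ifs with hn
  · obtain ⟨u, hu⟩ := (mem_activeSet_iff n).1 hn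
    have hLU := ((lowerTerm_spec hμ hg hn).2.1 u hu).trans ((upperTerm_spec hμ hlam hg n).1 u hu)
    rw [measureReal_congr (winSet_ae_eq_Ioo hμ hlam hg hn), Real.volume_real_Ioo_of_le hLU.le,
      ← mul_sub, mul_div_cancel_left₀ _ (hg.1 n).ne']
  · rw [mem_activeSet_iff, Set.not_nonempty_iff_eq_empty] at hn
    rw [hn, measureReal_empty, zero_div]

theorem power_pos_iff (hlam : ∀ n, 0 < lam n) (hg : GoodGain lam g) (n : Fin N) :
    0 < power μ lam g n ↔ n ∈ activeSet μ lam g := by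
  unfold power
  rw [mem_activeSet_iff, div_pos_iff_of_pos_right (hg.1 n)]
  refine ⟨fun h => ?_, volume_real_winSet_pos (hg.price_pos hlam)⟩
  by_contra hn
  rw [Set.not_nonempty_iff_eq_empty] at hn
  rw [hn, measureReal_empty] at h
  exact h.false

theorem power_nonneg (hg : ∀ n, 0 ≤ g n) (n : Fin N) : 0 ≤ power μ lam g n :=
  div_nonneg measureReal_nonneg (hg n)

/-- A user wins only levels below `μ n * g n / lam n`. The resulting bound does not depend on the
gains, which serves both integrability and the control of battery shortages. -/
theorem power_le (hμ : ∀ n, 0 < μ n) (hlam : ∀ n, 0 < lam n) (hg : GoodGain lam g) (n : Fin N) :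
    power μ lam g n ≤ μ n / lam n := by
  unfold power
  have hc := hg.price_pos hlam
  rw [div_le_iff₀ (hg.1 n)]
  have h1 : winSet μ (fun k => lam k / g k) n ⊆ Set.Ioo 0 (μ n / (lam n / g n)) :=
    (winSet_subset hc n).trans (Set.Ioo_subset_Ioo_left zero_le_one)
  have h2 := measureReal_mono (μ := volume) h1 measure_Ioo_lt_top.ne
  rw [Real.volume_real_Ioo_of_le (div_pos (hμ n) (hc n)).le, sub_zero, div_div_eq_mul_div,
    mul_div_right_comm] at h2
  exact h2

/-! ### Rates -/

theorem one_add_sum_eq_stack (P : Fin N → ℝ) (n : Fin N) :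
    1 + ∑ k ∈ Finset.univ.filter (· < n), P k * g k = stack (fun k => P k * g k) n := rfl

theorem log_two_mul_rate (hg : ∀ n, 0 ≤ g n) {P : Fin N → ℝ} (hP : ∀ n, 0 ≤ P n) (n : Fin N) :
    Real.log 2 * rate g P n =
      Real.log (stack (fun k => P k * g k) (n + 1) / stack (fun k => P k * g k) n) := by
  have h1 := one_le_stack (v := fun k => P k * g k) (fun k => mul_nonneg (hP k) (hg k)) n
  unfold rate
  rw [one_add_sum_eq_stack, Real.logb, mul_div_cancel₀ _ (Real.log_pos one_lt_two).ne', stack_succ,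
    add_div, div_self (zero_lt_one.trans_le h1).ne']

theorem rate_nonneg (hg : ∀ n, 0 ≤ g n) {P : Fin N → ℝ} (hP : ∀ n, 0 ≤ P n) (n : Fin N) :
    0 ≤ rate g P n := by
  have hv : ∀ k, 0 ≤ P k * g k := fun k => mul_nonneg (hP k) (hg k)
  have h1 := one_le_stack hv n
  refine Real.logb_nonneg one_lt_two ?_
  rw [one_add_sum_eq_stack]
  have : 0 ≤ P n * g n / stack (fun k => P k * g k) n := div_nonneg (hv n) (by linarith)
  linarith

theorem log_two_mul_rate_le (hg : ∀ n, 0 ≤ g n) {P : Fin N → ℝ} (hP : ∀ n, 0 ≤ P n) (n : Fin N) :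
    Real.log 2 * rate g P n ≤ P n * g n := by
  have hv : ∀ k, 0 ≤ P k * g k := fun k => mul_nonneg (hP k) (hg k)
  have h1 := one_le_stack hv n
  have h2 := stack_le_succ hv n
  rw [log_two_mul_rate hg hP]
  refine (Real.log_le_sub_one_of_pos (div_pos (by linarith) (by linarith))).trans ?_
  rw [stack_succ, add_div, div_self (zero_lt_one.trans_le h1).ne', add_sub_cancel_left]
  exact div_le_self (hv n) h1

theorem lagrangian_eq (hg : GoodGain lam g) {P : Fin N → ℝ} (hP : ∀ n, 0 ≤ P n) :
    lagrangian μ lam g P = ∑ n : Fin N, (μ n * Real.log (stack (fun k => P k * g k) (n + 1)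
      / stack (fun k => P k * g k) n) - lam n / g n * (P n * g n)) := by
  refine Finset.sum_congr rfl fun n _ => ?_
  rw [log_two_mul_rate (fun n => (hg.1 n).le) hP]
  congr 1
  have := (hg.1 n).ne'
  field_simp

/-- The powers given by the winning sets maximize the Lagrangian. -/
theorem lagrangian_le (hμ : Antitone μ) (hlam : ∀ n, 0 < lam n) (hg : GoodGain lam g)
    {P : Fin N → ℝ} (hP : ∀ n, 0 ≤ P n) :
    lagrangian μ lam g P ≤ lagrangian μ lam g (power μ lam g) := by
  have hg0 : ∀ n, 0 ≤ g n := fun n => (hg.1 n).le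
  have hc := hg.price_pos hlam
  rw [lagrangian_eq hg hP, lagrangian_eq hg (power_nonneg hg0)]
  have h1 : (fun n => power μ lam g n * g n)
      = fun n => volume.real (winSet μ (fun k => lam k / g k) n) := by
    funext n
    exact div_mul_cancel₀ _ (hg.1 n).ne'
  have h2 := sum_eq_netValue hμ hc hg.2
  rw [← h1] at h2
  have h3 : ∀ n, volume.real (winSet μ (fun k => lam k / g k) n) = power μ lam g n * g n :=
    fun n => (congrFun h1 n).symm
  simp only [h3] at h2
  rw [h2]
  exact sum_le_netValue hc hg.2 fun n => mul_nonneg (hP n) (hg0 n)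

/-- The Lagrangian is affine in the multipliers for fixed powers; this is the source of the
subgradient inequality for the dual. -/
theorem lagrangian_sub (lam lam' g P : Fin N → ℝ) :
    lagrangian μ lam' g P = lagrangian μ lam g P - ∑ n, (lam' n - lam n) * P n := by
  unfold lagrangian
  rw [← Finset.sum_sub_distrib]
  exact Finset.sum_congr rfl fun n _ => by ring

/-- The length of a winning set is the measure of a section of a measurable set of pairs (gains,
level). -/
theorem measurable_power (μ lam : Fin N → ℝ) (n : Fin N) :
    Measurable fun g : Fin N → ℝ => power μ lam g n := by
  have hS : MeasurableSet {p : (Fin N → ℝ) × ℝ | p.2 ∈ winSet μ (fun k => lam k / p.1 k) n} := by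
    have hφ : ∀ k, Measurable fun p : (Fin N → ℝ) × ℝ => μ k / p.2 - lam k / p.1 k := fun k =>
      (measurable_snd.const_div _).sub (((measurable_pi_apply k).comp measurable_fst).const_div _)
    have : {p : (Fin N → ℝ) × ℝ | p.2 ∈ winSet μ (fun k => lam k / p.1 k) n}
        = {p | 1 < p.2} ∩ ({p | 0 < μ n / p.2 - lam n / p.1 n} ∩ ⋂ k, ⋂ (_ : k ≠ n),
          {p | μ k / p.2 - lam k / p.1 k < μ n / p.2 - lam n / p.1 n}) := by
      ext p
      simp [winSet]
    rw [this]
    exact (measurableSet_lt measurable_const measurable_snd).inter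
      ((measurableSet_lt measurable_const (hφ n)).inter
        (MeasurableSet.iInter fun k => MeasurableSet.iInter fun _ =>
          measurableSet_lt (hφ k) (hφ n)))
  exact (measurable_measure_prodMk_left (ν := volume) hS).ennreal_toReal.div (measurable_pi_apply n)

theorem measurable_rate_comp {P : (Fin N → ℝ) → Fin N → ℝ} (hP : ∀ n, Measurable fun g => P g n)
    (n : Fin N) : Measurable fun g : Fin N → ℝ => rate g (P g) n := by
  have hv : ∀ k, Measurable fun g : Fin N → ℝ => P g k * g k := fun k =>
    (hP k).mul (measurable_pi_apply k)
  exact (Real.measurable_log.comp (measurable_const.add ((hv n).div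
    (measurable_const.add (Finset.measurable_fun_sum _ fun k _ => hv k))))).div_const _

theorem measurableSet_goodGain (lam : Fin N → ℝ) : MeasurableSet {g | GoodGain lam g} := by
  have : {g : Fin N → ℝ | GoodGain lam g} = (⋂ n, {g | 0 < g n}) ∩
      ⋂ j, ⋂ k, ⋂ (_ : j ≠ k), {g | lam j / g j = lam k / g k}ᶜ := by
    ext g
    simp only [GoodGain, Function.Injective, Set.mem_ofPred_eq, Set.mem_inter_iff, Set.mem_iInter,
      Set.mem_compl_iff]
    exact and_congr_right fun _ => ⟨fun h j k hjk he => hjk (h he),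
      fun h j k he => by_contra fun hjk => h j k hjk he⟩
  rw [this]
  have hm : ∀ j, Measurable fun g : Fin N → ℝ => lam j / g j := fun j =>
    (measurable_pi_apply j).const_div _
  exact (MeasurableSet.iInter fun n =>
    measurableSet_lt measurable_const (measurable_pi_apply n)).inter
    (MeasurableSet.iInter fun j => MeasurableSet.iInter fun k => MeasurableSet.iInter fun _ =>
      (measurableSet_eq_fun (hm j) (hm k)).compl)

end Powers

/-! ### Almost sure absence of ties between prices -/

section Fading

variable {Ω : Type*} [MeasurableSpace Ω] {ℙ : Measure Ω} {g : ℕ → Ω → Fin N → ℝ}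

theorem IsFading.ae_pos (h : IsFading ℙ g) (n : Fin N) : ∀ᵐ ω ∂ℙ, 0 < g 0 ω n := by
  have h1 := h.hyperplane (Pi.single n 1) (by simp) 0
  rw [measure_eq_zero_iff_ae_notMem] at h1
  filter_upwards [h1] with ω hω
  refine (h.nonneg 0 ω n).lt_of_ne fun h0 => hω ?_
  simp [Pi.single_apply, ← h0]

/-- Equal prices of `j` and `k` place the gain vector on the hyperplane `lam j * g k = lam k * g j`.
-/
theorem IsFading.ae_goodGain_zero (h : IsFading ℙ g) {lam : Fin N → ℝ} (hlam : ∀ n, 0 < lam n) :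
    ∀ᵐ ω ∂ℙ, GoodGain lam (g 0 ω) := by
  have h1 : ∀ j k : Fin N, j ≠ k → ∀ᵐ ω ∂ℙ, lam j * g 0 ω k - lam k * g 0 ω j ≠ 0 := by
    intro j k hjk
    have h2 := h.hyperplane (Pi.single k (lam j) - Pi.single j (lam k)) (fun h0 => by
      have := congrFun h0 k
      simp [hjk.symm, (hlam j).ne'] at this) 0
    rw [measure_eq_zero_iff_ae_notMem] at h2
    filter_upwards [h2] with ω hω h0
    refine hω ?_
    simp only [Pi.sub_apply, sub_mul, Finset.sum_sub_distrib, Pi.single_apply,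
      ite_mul, zero_mul, Finset.sum_ite_eq', Finset.mem_univ, if_true]
    exact h0
  have h3 : ∀ᵐ ω ∂ℙ, ∀ j k : Fin N, j ≠ k → lam j * g 0 ω k - lam k * g 0 ω j ≠ 0 := by
    refine ae_all_iff.2 fun j => ae_all_iff.2 fun k => ?_
    by_cases hjk : j = k
    · exact Eventually.of_forall fun ω h => absurd hjk h
    · filter_upwards [h1 j k hjk] with ω hω _ using hω
  filter_upwards [ae_all_iff.2 h.ae_pos, h3] with ω hpos hω
  refine ⟨hpos, fun j k he => by_contra fun hjk => hω j k hjk ?_⟩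
  simp only at he
  rw [div_eq_div_iff (hpos j).ne' (hpos k).ne'] at he
  linarith

theorem IsFading.ae_goodGain (h : IsFading ℙ g) {lam : Fin N → ℝ} (hlam : ∀ n, 0 < lam n) :
    ∀ᵐ ω ∂ℙ, ∀ i, GoodGain lam (g i ω) :=
  h.stationaryErgodic.ae_all (measurableSet_goodGain lam) (h.ae_goodGain_zero hlam)

end Fading

/-! ### Upper limits of time averages -/

theorem avg_add (u v : ℕ → ℝ) (M : ℕ) : avg (fun i => u i + v i) M = avg u M + avg v M := by
  simp only [avg, Finset.sum_add_distrib, add_div]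

theorem avg_sub (u v : ℕ → ℝ) (M : ℕ) : avg (fun i => u i - v i) M = avg u M - avg v M := by
  simp only [avg, Finset.sum_sub_distrib, sub_div]

theorem avg_const_mul (a : ℝ) (u : ℕ → ℝ) (M : ℕ) : avg (fun i => a * u i) M = a * avg u M := by
  simp only [avg, ← Finset.mul_sum, mul_div_assoc]

theorem avg_sum {ι : Type*} (S : Finset ι) (u : ι → ℕ → ℝ) (M : ℕ) :
    avg (fun i => ∑ n ∈ S, u n i) M = ∑ n ∈ S, avg (u n) M := by
  simp only [avg]
  rw [Finset.sum_comm, Finset.sum_div]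

theorem avg_mono {u v : ℕ → ℝ} (h : ∀ i, u i ≤ v i) (M : ℕ) : avg u M ≤ avg v M :=
  div_le_div_of_nonneg_right (Finset.sum_le_sum fun i _ => h i) (Nat.cast_nonneg M)

theorem LimsupLE.mono {u v : ℕ → ℝ} {a : ℝ} (hv : LimsupLE v a) (h : ∀ M, u M ≤ v M) :
    LimsupLE u a := fun δ hδ => (hv δ hδ).mono fun M hM => (h M).trans hM

theorem LimsupLE.of_tendsto {u : ℕ → ℝ} {a : ℝ} (h : Tendsto u atTop (𝓝 a)) : LimsupLE u a :=
  fun _ hδ => h.eventually (ge_mem_nhds (lt_add_of_pos_right a hδ))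

theorem LimsupLE.add {u v : ℕ → ℝ} {a b : ℝ} (hu : LimsupLE u a) (hv : LimsupLE v b) :
    LimsupLE (fun M => u M + v M) (a + b) := fun δ hδ => by
  filter_upwards [hu (δ / 2) (half_pos hδ), hv (δ / 2) (half_pos hδ)] with M h1 h2
  linarith

theorem LimsupLE.const_mul {u : ℕ → ℝ} {a c : ℝ} (hu : LimsupLE u a) (hc : 0 ≤ c) :
    LimsupLE (fun M => c * u M) (c * a) := fun δ hδ => by
  filter_upwards [hu (δ / (c + 1)) (by positivity)] with M h1
  have h2 : c * (δ / (c + 1)) ≤ δ := by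
    rw [mul_div_assoc', div_le_iff₀ (by positivity)]
    nlinarith
  nlinarith [mul_le_mul_of_nonneg_left h1 hc]

theorem LimsupLE.sum {ι : Type*} (S : Finset ι) {u : ι → ℕ → ℝ} {a : ι → ℝ}
    (h : ∀ n ∈ S, LimsupLE (u n) (a n)) : LimsupLE (fun M => ∑ n ∈ S, u n M) (∑ n ∈ S, a n) := by
  classical
  induction S using Finset.induction_on with
  | empty => exact .of_tendsto (by simp)
  | insert n S hn ih =>
    simp only [Finset.sum_insert hn]
    exact (h n (Finset.mem_insert_self n S)).add
      (ih fun k hk => h k (Finset.mem_insert_of_mem hk))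

theorem LimsupLE.tendsto_zero {u : ℕ → ℝ} (h : LimsupLE u 0) (h0 : ∀ M, 0 ≤ u M) :
    Tendsto u atTop (𝓝 0) := by
  rw [Metric.tendsto_atTop']
  intro δ hδ
  obtain ⟨m, hm⟩ := eventually_atTop.1 (h (δ / 2) (half_pos hδ))
  refine ⟨m, fun M hM => ?_⟩
  rw [Real.dist_eq, sub_zero, abs_of_nonneg (h0 M)]
  linarith [hm M hM.le]

/-- The constant absorbs the finitely many partial sums before the bound on the averages takes
effect. -/
theorem exists_sum_le_of_avg {u : ℕ → ℝ} (h : LimsupLE (avg u) 0) {δ : ℝ} (hδ : 0 < δ) :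
    ∃ C : ℝ, 0 ≤ C ∧ ∀ M, ∑ i ∈ Finset.range M, u i ≤ C + δ * M := by
  obtain ⟨m, hm⟩ := eventually_atTop.1 (h δ hδ)
  refine ⟨∑ M ∈ Finset.range (m + 1), |∑ i ∈ Finset.range M, u i|,
    Finset.sum_nonneg fun _ _ => abs_nonneg _, fun M => ?_⟩
  have hC : 0 ≤ ∑ M ∈ Finset.range (m + 1), |∑ i ∈ Finset.range M, u i| :=
    Finset.sum_nonneg fun _ _ => abs_nonneg _
  rcases lt_or_ge M (m + 1) with hM | hM
  · have h1 : |∑ i ∈ Finset.range M, u i| ≤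
        ∑ M ∈ Finset.range (m + 1), |∑ i ∈ Finset.range M, u i| :=
      Finset.single_le_sum (f := fun M => |∑ i ∈ Finset.range M, u i|) (fun _ _ => abs_nonneg _)
        (Finset.mem_range.2 hM)
    have h2 : 0 ≤ δ * M := by positivity
    linarith [le_abs_self (∑ i ∈ Finset.range M, u i)]
  · have h1 := hm M (by omega)
    have hM0 : (0 : ℝ) < M := Nat.cast_pos.2 (by omega)
    rw [zero_add, avg, div_le_iff₀ hM0] at h1
    linarith

/-! ### The upper bound along one realization -/

theorem System.η'_pos (s : System N) : 0 < s.η' :=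
  div_pos (mul_pos s.η_pos s.N₀_pos) (zero_lt_one.trans s.one_lt_ε)

theorem System.ε_pos (s : System N) : 0 < s.ε := zero_lt_one.trans s.one_lt_ε

theorem System.Pmax_pos (s : System N) : 0 < s.Pmax := s.Pavg_pos.trans_le s.Pavg_le

theorem bsPower_mem (s : System N) (lam : Fin N → ℝ) (lam0 : ℝ) (h : Fin N → ℝ) :
    0 ≤ bsPower s lam lam0 h ∧ bsPower s lam lam0 h ≤ s.Pmax := by
  unfold bsPower
  split_ifs
  · exact ⟨s.Pmax_pos.le, le_rfl⟩
  · exact ⟨le_rfl, s.Pmax_pos.le⟩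

/-- The on-off power maximizes the value of the harvested energy, less the price of the BS power. -/
theorem mul_le_bsPower_mul (s : System N) (lam : Fin N → ℝ) (lam0 : ℝ) (h : Fin N → ℝ) {q : ℝ}
    (hq0 : 0 ≤ q) (hq : q ≤ s.Pmax) :
    q * (s.η' * ∑ n, lam n * h n - lam0) ≤
      bsPower s lam lam0 h * (s.η' * ∑ n, lam n * h n - lam0) := by
  unfold bsPower
  have h1 : lam0 / s.η' ≤ ∑ n, lam n * h n ↔ lam0 ≤ s.η' * ∑ n, lam n * h n :=
    div_le_iff₀' s.η'_pos
  split_ifs with hh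
  · exact mul_le_mul_of_nonneg_right hq (sub_nonneg.2 (h1.1 hh))
  · rw [h1, not_le] at hh
    rw [zero_mul]
    exact mul_nonpos_of_nonneg_of_nonpos hq0 (sub_neg.2 hh).le

/-- Weak duality along a realization. The balance of the competitor is only required from one side,
so that powers actually drawn from batteries and balanced desired powers are both covered. No
causality enters, since the comparison is made in each slot separately. -/
theorem limsupLE_weightedRate (s : System N) {lam : Fin N → ℝ} {lam0 : ℝ} {x y : ℕ → Fin N → ℝ}
    (hlam : ∀ n, 0 < lam n) (hlam0 : 0 ≤ lam0) (hgood : ∀ i, GoodGain lam (x i))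
    (heq : MultiplierEquations s lam lam0 x y) {R : Fin N → ℝ}
    (hR : ∀ n, Tendsto (avg fun i => rate (x i) (ehuPower s.μ lam (x i)) n) atTop (𝓝 (R n)))
    {Q : ℕ → Fin N → ℝ} (hQ : ∀ i n, 0 ≤ Q i n) {q : ℕ → ℝ}
    (hq : ∀ i, 0 ≤ q i ∧ q i ≤ s.Pmax) (hqavg : LimsupLE (avg q) s.Pavg)
    (hbal : ∀ n, LimsupLE (avg fun i => Q i n - s.η' * q i * y i n) 0) :
    LimsupLE (avg fun i => ∑ n, s.μ n * rate (x i) (Q i) n) (∑ n, s.μ n * R n) := by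
  have hlog : 0 < Real.log 2 := Real.log_pos one_lt_two
  set P : ℕ → Fin N → ℝ := fun i => ehuPower s.μ lam (x i) with hP
  set p : ℕ → ℝ := fun i => bsPower s lam lam0 (y i) with hp
  -- The Lagrangian counts rates in nats, hence the factor `(Real.log 2)⁻¹`. Competitor and proposed
  -- policy are kept apart because only upper limits are known for the former, while the averages of
  -- the latter converge and so may be multiplied by `-1`.
  have hslot : ∀ i, ∑ n, s.μ n * rate (x i) (Q i) n ≤
      ∑ n, s.μ n * rate (x i) (P i) n + (Real.log 2)⁻¹ *
        (∑ n, lam n * ((Q i n - s.η' * q i * y i n) + -1 * (P i n - s.η' * p i * y i n))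
          + lam0 * (q i + -1 * p i)) := by
    intro i
    have h1 := lagrangian_le s.μ_antitone hlam (hgood i) (hQ i)
    rw [← ehuPower_eq_power s.μ_antitone hlam (hgood i)] at h1
    have h2 := mul_le_bsPower_mul s lam lam0 (y i) (hq i).1 (hq i).2
    have h3 : ∀ W, lagrangian s.μ lam (x i) W
        = Real.log 2 * ∑ n, s.μ n * rate (x i) W n - ∑ n, lam n * W n := by
      intro W
      unfold lagrangian
      rw [Finset.sum_sub_distrib, Finset.mul_sum]
      congr 1
      exact Finset.sum_congr rfl fun n _ => by ring
    rw [h3, h3] at h1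
    have h4 : ∑ n, lam n * ((Q i n - s.η' * q i * y i n) + -1 * (P i n - s.η' * p i * y i n))
        = ∑ n, lam n * Q i n - ∑ n, lam n * P i n
          - q i * (s.η' * ∑ n, lam n * y i n) + p i * (s.η' * ∑ n, lam n * y i n) := by
      simp only [Finset.mul_sum]
      rw [← Finset.sum_sub_distrib, ← Finset.sum_sub_distrib, ← Finset.sum_add_distrib]
      exact Finset.sum_congr rfl fun n _ => by ring
    rw [h4, ← sub_le_iff_le_add', ← div_eq_inv_mul, le_div_iff₀ hlog]
    simp only [hP, hp]
    linarith
  have hWavg : LimsupLE (avg fun i => ∑ n, s.μ n * rate (x i) (P i) n) (∑ n, s.μ n * R n) := by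
    have : (avg fun i => ∑ n, s.μ n * rate (x i) (P i) n)
        = fun M => ∑ n, s.μ n * avg (fun i => rate (x i) (P i) n) M := by
      funext M
      rw [avg_sum]
      exact Finset.sum_congr rfl fun n _ => avg_const_mul _ _ _
    rw [this]
    exact LimsupLE.sum _ fun n _ => (LimsupLE.of_tendsto (hR n)).const_mul (s.μ_pos n).le
  have hPavg : ∀ n, LimsupLE (fun M => -1 * avg (fun i => P i n - s.η' * p i * y i n) M) 0 := by
    intro n
    have h1 := (heq.1 n).const_mul (-1)
    rw [mul_zero] at h1
    refine LimsupLE.of_tendsto (h1.congr fun M => ?_)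
    rw [avg_sub]
    rfl
  have hpavg : LimsupLE (fun M => -1 * avg p M) (-s.Pavg) := by
    have h1 := heq.2.const_mul (-1)
    rw [neg_one_mul] at h1
    exact LimsupLE.of_tendsto h1
  have hsum : LimsupLE (fun M => ∑ n, lam n * (avg (fun i => Q i n - s.η' * q i * y i n) M
      + -1 * avg (fun i => P i n - s.η' * p i * y i n) M)) (∑ n : Fin N, lam n * (0 + 0)) :=
    LimsupLE.sum _ fun n _ => ((hbal n).add (hPavg n)).const_mul (hlam n).le
  have htot := hWavg.add ((hsum.add ((hqavg.add hpavg).const_mul hlam0)).const_mul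
    (inv_nonneg.2 hlog.le))
  simp only [add_zero, mul_zero, Finset.sum_const_zero, add_neg_cancel] at htot
  refine htot.mono fun M => (avg_mono hslot M).trans (le_of_eq ?_)
  rw [avg_add, avg_const_mul, avg_add, avg_const_mul, avg_add, avg_const_mul, avg_sum, avg_sum]
  simp only [avg_const_mul, avg_add]

/-! ### Batteries -/

section Battery

variable {s : System N} {b : Fin N → ℝ} {y : ℕ → Fin N → ℝ} {p : Policy N}

theorem battery_nonneg (hb : ∀ n, 0 ≤ b n) (hy : ∀ i n, 0 ≤ y i n) (hp : ∀ i, 0 ≤ p.p0 i)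
    (n : Fin N) (i : ℕ) : 0 ≤ battery s b y p n i := by
  induction i with
  | zero => exact hb n
  | succ i ih =>
    have h1 : 0 ≤ s.η * s.N₀ * p.p0 i * y i n :=
      mul_nonneg (mul_nonneg (mul_pos s.η_pos s.N₀_pos).le (hp i)) (hy i n)
    have h2 : s.ε * min (battery s b y p n i / s.ε) (p.pd i n) ≤ battery s b y p n i := by
      refine (mul_le_mul_of_nonneg_left (min_le_left _ _) s.ε_pos.le).trans (le_of_eq ?_)
      exact mul_div_cancel₀ _ s.ε_pos.ne'
    change 0 ≤ battery s b y p n i + s.η * s.N₀ * p.p0 i * y i n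
      - s.ε * min (battery s b y p n i / s.ε) (p.pd i n)
    linarith

theorem pout_nonneg (hb : ∀ n, 0 ≤ b n) (hy : ∀ i n, 0 ≤ y i n) (hp : ∀ i, 0 ≤ p.p0 i)
    (hpd : ∀ i n, 0 ≤ p.pd i n) (i : ℕ) (n : Fin N) : 0 ≤ pout s b y p i n :=
  le_min (div_nonneg (battery_nonneg hb hy hp n i) s.ε_pos.le) (hpd i n)

theorem pout_le (i : ℕ) (n : Fin N) : pout s b y p i n ≤ p.pd i n := min_le_right _ _

theorem battery_succ_div (n : Fin N) (i : ℕ) :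
    battery s b y p n (i + 1) / s.ε
      = battery s b y p n i / s.ε + s.η' * p.p0 i * y i n - pout s b y p i n := by
  have := s.ε_pos.ne'
  change (battery s b y p n i + s.η * s.N₀ * p.p0 i * y i n - s.ε * pout s b y p i n) / s.ε = _
  unfold System.η'
  field_simp

/-- Conservation of energy: the battery content telescopes. -/
theorem sum_pout_sub (n : Fin N) (M : ℕ) :
    ∑ i ∈ Finset.range M, (pout s b y p i n - s.η' * p.p0 i * y i n)
      = b n / s.ε - battery s b y p n M / s.ε := by
  induction M with
  | zero => simp [battery]
  | succ M ih => rw [Finset.sum_range_succ, ih, battery_succ_div]; ring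

/-- On average, the users transmit at most the harvested power. -/
theorem limsupLE_pout_sub (hb : ∀ n, 0 ≤ b n) (hy : ∀ i n, 0 ≤ y i n) (hp : ∀ i, 0 ≤ p.p0 i)
    (n : Fin N) : LimsupLE (avg fun i => pout s b y p i n - s.η' * p.p0 i * y i n) 0 := by
  refine (LimsupLE.of_tendsto (tendsto_const_div_atTop_nhds_zero_nat (b n / s.ε))).mono fun M => ?_
  unfold avg
  rw [sum_pout_sub]
  have : 0 ≤ battery s b y p n M / s.ε := div_nonneg (battery_nonneg hb hy hp n M) s.ε_pos.le
  exact div_le_div_of_nonneg_right (by linarith) (Nat.cast_nonneg M)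

/-- A slot without shortage adds nothing. In a slot with shortage all stored energy is transmitted,
so the accumulated shortfall is the accumulated desired minus harvested power up to that slot, less
the initial content, plus one desired power, at most `K`. -/
theorem sum_shortfall_le (hb : ∀ n, 0 ≤ b n) {n : Fin N} {K C δ : ℝ} (hK : 0 ≤ K)
    (hC : 0 ≤ C) (hδ : 0 ≤ δ) (hpd : ∀ i, p.pd i n ≤ K)
    (h : ∀ M : ℕ, ∑ i ∈ Finset.range M, (p.pd i n - s.η' * p.p0 i * y i n) ≤ C + δ * M) (M : ℕ) :
    ∑ i ∈ Finset.range M, (p.pd i n - pout s b y p i n) ≤ K + C + δ * M := by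
  induction M with
  | zero => simpa using add_nonneg hK hC
  | succ M ih =>
    rcases le_or_gt (p.pd M n) (battery s b y p n M / s.ε) with hle | hlt
    · have h1 : pout s b y p M n = p.pd M n := min_eq_right hle
      rw [Finset.sum_range_succ, h1, sub_self, add_zero]
      push_cast
      linarith
    · have h1 : pout s b y p M n = battery s b y p n M / s.ε := min_eq_left hlt.le
      have h2 := sum_pout_sub (s := s) (b := b) (y := y) (p := p) n M
      have h3 := h M
      have h4 := div_nonneg (hb n) s.ε_pos.le
      rw [Finset.sum_range_succ, h1]
      -- By energy conservation the second sum contains the current content with a minus sign, which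
      -- cancels against the power transmitted in slot `M`.
      have h5 : ∑ i ∈ Finset.range M, (p.pd i n - pout s b y p i n)
          = ∑ i ∈ Finset.range M, (p.pd i n - s.η' * p.p0 i * y i n)
            - ∑ i ∈ Finset.range M, (pout s b y p i n - s.η' * p.p0 i * y i n) := by
        rw [← Finset.sum_sub_distrib]
        exact Finset.sum_congr rfl fun i _ => by ring
      rw [h5, h2]
      push_cast
      linarith [hpd M]

/-- Under the energy balance, lack of stored energy costs no average power. -/
theorem limsupLE_shortfall (hb : ∀ n, 0 ≤ b n) {n : Fin N} {K : ℝ} (hK : 0 ≤ K)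
    (hpd : ∀ i, p.pd i n ≤ K) (hbal : EnergyBalance s y p) :
    LimsupLE (avg fun i => p.pd i n - pout s b y p i n) 0 := by
  intro δ hδ
  have h1 : LimsupLE (avg fun i => p.pd i n - s.η' * p.p0 i * y i n) 0 :=
    LimsupLE.of_tendsto ((hbal n).congr fun M => (avg_sub _ _ M).symm)
  obtain ⟨C, hC, h2⟩ := exists_sum_le_of_avg h1 (half_pos hδ)
  have h3 := sum_shortfall_le hb hK hC (half_pos hδ).le hpd h2
  filter_upwards [eventually_gt_atTop 0,
    (tendsto_const_div_atTop_nhds_zero_nat (K + C)).eventually (gt_mem_nhds (half_pos hδ))]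
    with M hM hM2
  have hM' : (0 : ℝ) < M := Nat.cast_pos.2 hM
  rw [div_lt_iff₀ hM'] at hM2
  unfold avg
  rw [div_le_iff₀ hM']
  linarith [h3 M]

theorem log_stack_sub_le {v w : Fin N → ℝ} (hv : ∀ n, 0 ≤ v n) (hvw : ∀ n, v n ≤ w n) (m : ℕ) :
    0 ≤ Real.log (stack w m) - Real.log (stack v m) ∧
      Real.log (stack w m) - Real.log (stack v m) ≤ ∑ n, (w n - v n) := by
  have h1 := one_le_stack hv m
  have h2 : stack v m ≤ stack w m := add_le_add le_rfl (Finset.sum_le_sum fun n _ => hvw n)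
  have h3 : stack w m - stack v m ≤ ∑ n, (w n - v n) := by
    unfold stack
    rw [add_sub_add_left_eq_sub, ← Finset.sum_sub_distrib]
    exact Finset.sum_le_univ_sum_of_nonneg fun n => sub_nonneg.2 (hvw n)
  refine ⟨sub_nonneg.2 (Real.log_le_log (by linarith) h2), le_trans ?_ h3⟩
  rw [← Real.log_div (by linarith) (by linarith)]
  refine (Real.log_le_sub_one_of_pos (div_pos (by linarith) (by linarith))).trans ?_
  have h4 : stack w m / stack v m - 1 = (stack w m - stack v m) / stack v m := by
    rw [sub_div, div_self (by linarith)]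
  rw [h4]
  exact div_le_self (sub_nonneg.2 h2) h1

/-- A rate is a difference of logarithms of two stacks. Passing from `P` to `Q` raises each
logarithm by an amount between 0 and the total increase of received power, so the difference moves
by no more than that. -/
theorem abs_rate_sub_le {g P Q : Fin N → ℝ} (hg : ∀ n, 0 ≤ g n) (hP : ∀ n, 0 ≤ P n)
    (hPQ : ∀ n, P n ≤ Q n) (n : Fin N) :
    |rate g P n - rate g Q n| ≤ (Real.log 2)⁻¹ * ∑ k, (Q k - P k) * g k := by
  have hlog : 0 < Real.log 2 := Real.log_pos one_lt_two
  have hv : ∀ k, 0 ≤ P k * g k := fun k => mul_nonneg (hP k) (hg k)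
  have hvw : ∀ k, P k * g k ≤ Q k * g k := fun k => mul_le_mul_of_nonneg_right (hPQ k) (hg k)
  have hw : ∀ k, 0 ≤ Q k * g k := fun k => (hv k).trans (hvw k)
  have h1 := log_stack_sub_le hv hvw n
  have h2 := log_stack_sub_le hv hvw (n + 1)
  have h3 := log_two_mul_rate hg hP n
  have h4 := log_two_mul_rate hg (fun k => (hP k).trans (hPQ k)) n
  have hpos : ∀ {v : Fin N → ℝ}, (∀ k, 0 ≤ v k) → ∀ m, stack v m ≠ 0 := fun hv m =>
    (zero_lt_one.trans_le (one_le_stack hv m)).ne'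
  rw [Real.log_div (hpos hv _) (hpos hv _)] at h3
  rw [Real.log_div (hpos hw _) (hpos hw _)] at h4
  simp only [← sub_mul] at h1 h2
  rw [← div_eq_inv_mul, le_div_iff₀ hlog]
  nth_rw 1 [← abs_of_pos hlog]
  rw [← abs_mul, sub_mul, mul_comm _ (Real.log 2), mul_comm _ (Real.log 2), h3, h4, abs_le]
  constructor <;> linarith

/-- The averages of the gains above a high enough level are small. -/
def SmallTails (x : ℕ → Fin N → ℝ) : Prop :=
  ∀ n, ∀ δ > 0, ∃ K : ℕ, ∀ᶠ M in atTop, avg (fun i => if (K : ℝ) < x i n then x i n else 0) M ≤ δ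

/-- The gains may be unbounded, so they are cut at a level `K`: below it the average is at most `K`
times that of `u`, above it at most `C` times a small tail. -/
theorem limsupLE_mul_of_smallTails {x : ℕ → Fin N → ℝ} (hx0 : ∀ i n, 0 ≤ x i n)
    (hx : SmallTails x) {u : ℕ → ℝ} {C : ℝ} (hu0 : ∀ i, 0 ≤ u i) (huC : ∀ i, u i ≤ C) (n : Fin N)
    (hu : LimsupLE (avg u) 0) : LimsupLE (avg fun i => u i * x i n) 0 := by
  intro δ hδ
  have hC : 0 ≤ C := (hu0 0).trans (huC 0)
  obtain ⟨K, hK⟩ := hx n (δ / 2 / (C + 1)) (by positivity)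
  filter_upwards [hK, hu.const_mul (Nat.cast_nonneg K) (δ / 2) (half_pos hδ)] with M h1 h2
  have h3 : ∀ i, u i * x i n ≤ K * u i + C * (if (K : ℝ) < x i n then x i n else 0) := by
    intro i
    split_ifs with h
    · have h4 := mul_le_mul_of_nonneg_right (huC i) (hx0 i n)
      have h5 : 0 ≤ (K : ℝ) * u i := mul_nonneg (Nat.cast_nonneg K) (hu0 i)
      linarith
    · rw [mul_zero, add_zero, mul_comm]
      exact mul_le_mul_of_nonneg_right (not_lt.1 h) (hu0 i)
  refine (avg_mono h3 M).trans ?_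
  rw [avg_add, avg_const_mul, avg_const_mul]
  have h4 : C * (δ / 2 / (C + 1)) ≤ δ / 2 := by
    rw [mul_div_assoc', div_le_iff₀ (by positivity)]
    nlinarith
  nlinarith [mul_le_mul_of_nonneg_left h1 hC]

/-- Transfers the rates from the problem without batteries to the one with batteries: the missing
received power has zero average. -/
theorem tendsto_avg_rate_pout {x : ℕ → Fin N → ℝ} (hx0 : ∀ i n, 0 ≤ x i n) (hx : SmallTails x)
    (hb : ∀ n, 0 ≤ b n) (hy : ∀ i n, 0 ≤ y i n) (hp : ∀ i, 0 ≤ p.p0 i)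
    (hpd : ∀ i n, 0 ≤ p.pd i n) {K : Fin N → ℝ} (hpK : ∀ i n, p.pd i n ≤ K n)
    (hbal : EnergyBalance s y p) {n : Fin N} {r : ℝ}
    (hr : Tendsto (avg fun i => rate (x i) (p.pd i) n) atTop (𝓝 r)) :
    Tendsto (avg fun i => rate (x i) (pout s b y p i) n) atTop (𝓝 r) := by
  have hpo := pout_nonneg (s := s) hb hy hp hpd
  have hK : ∀ k, 0 ≤ K k := fun k => (hpd 0 k).trans (hpK 0 k)
  have h1 : ∀ k, LimsupLE (avg fun i => (p.pd i k - pout s b y p i k) * x i k) 0 := fun k =>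
    limsupLE_mul_of_smallTails hx0 hx (C := K k) (fun i => sub_nonneg.2 (pout_le i k))
      (fun i => by linarith [hpo i k, hpK i k]) k
      (limsupLE_shortfall hb (hK k) (fun i => hpK i k) hbal)
  have h2 : LimsupLE (fun M => (Real.log 2)⁻¹ *
      ∑ k, avg (fun i => (p.pd i k - pout s b y p i k) * x i k) M) 0 := by
    have := (LimsupLE.sum Finset.univ fun k _ => h1 k).const_mul
      (inv_nonneg.2 (Real.log_pos one_lt_two).le)
    simpa using this
  have h3 : ∀ M, |avg (fun i => rate (x i) (pout s b y p i) n - rate (x i) (p.pd i) n) M| ≤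
      (Real.log 2)⁻¹ * ∑ k, avg (fun i => (p.pd i k - pout s b y p i k) * x i k) M := by
    intro M
    rw [← avg_sum, ← avg_const_mul]
    unfold avg
    rw [abs_div, abs_of_nonneg (Nat.cast_nonneg M : (0 : ℝ) ≤ M)]
    refine div_le_div_of_nonneg_right ?_ (Nat.cast_nonneg M)
    exact (Finset.abs_sum_le_sum_abs _ _).trans (Finset.sum_le_sum fun i _ =>
      abs_rate_sub_le (hx0 i) (hpo i) (fun k => pout_le i k) n)
  have h4 := squeeze_zero_norm (fun M => (Real.norm_eq_abs _).trans_le (h3 M))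
    (h2.tendsto_zero fun M => (abs_nonneg _).trans (h3 M))
  have h5 := hr.add h4
  rw [add_zero] at h5
  refine h5.congr fun M => ?_
  rw [avg_sub]
  ring

end Battery

/-! ### Optimality along one realization -/

section Optimality

variable {s : System N} {lam : Fin N → ℝ} {lam0 : ℝ} {x y : ℕ → Fin N → ℝ} {R : Fin N → ℝ}

theorem admissible_starPolicy (hlam : ∀ n, 0 < lam n) (hgood : ∀ i, GoodGain lam (x i))
    (heq : MultiplierEquations s lam lam0 x y) : Admissible s (starPolicy s lam lam0 x y) := by
  refine ⟨fun i n => ?_, fun i => bsPower_mem s lam lam0 (y i), LimsupLE.of_tendsto heq.2⟩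
  change 0 ≤ ehuPower s.μ lam (x i) n
  rw [ehuPower_eq_power s.μ_antitone hlam (hgood i)]
  exact power_nonneg (fun n => ((hgood i).1 n).le) n

theorem isOptimalBalanced_starPolicy (hlam : ∀ n, 0 < lam n) (hlam0 : 0 ≤ lam0)
    (hgood : ∀ i, GoodGain lam (x i)) (heq : MultiplierEquations s lam lam0 x y)
    (hR : ∀ n, Tendsto (avg fun i => rate (x i) (ehuPower s.μ lam (x i)) n) atTop (𝓝 (R n))) :
    IsOptimalBalanced s x y (starPolicy s lam lam0 x y) R := by
  refine ⟨⟨admissible_starPolicy hlam hgood heq, heq.1⟩, hR, fun q hq hbal => ?_⟩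
  exact limsupLE_weightedRate s hlam hlam0 hgood heq hR hq.1 hq.2.1 hq.2.2 fun n =>
    LimsupLE.of_tendsto ((hbal n).congr fun M => (avg_sub _ _ M).symm)

theorem isOptimal_starPolicy (hlam : ∀ n, 0 < lam n) (hlam0 : 0 ≤ lam0)
    (hgood : ∀ i, GoodGain lam (x i)) (hx : SmallTails x) (hy : ∀ i n, 0 ≤ y i n)
    (heq : MultiplierEquations s lam lam0 x y)
    (hR : ∀ n, Tendsto (avg fun i => rate (x i) (ehuPower s.μ lam (x i)) n) atTop (𝓝 (R n)))
    {b : Fin N → ℝ} (hb : ∀ n, 0 ≤ b n) :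
    IsOptimal s b x y (starPolicy s lam lam0 x y) R := by
  have hadm := admissible_starPolicy hlam hgood heq
  refine ⟨hadm, fun n => ?_, fun q hq => ?_⟩
  · refine tendsto_avg_rate_pout (K := fun k => s.μ k / lam k) (fun i n => ((hgood i).1 n).le) hx hb
      hy (fun i => (hadm.2.1 i).1) hadm.1 (fun i k => ?_) heq.1 (hR n)
    change ehuPower s.μ lam (x i) k ≤ _
    rw [ehuPower_eq_power s.μ_antitone hlam (hgood i)]
    exact power_le s.μ_pos hlam (hgood i) k
  · have hq0 : ∀ i, 0 ≤ q.p0 i := fun i => (hq.2.1 i).1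
    exact limsupLE_weightedRate s hlam hlam0 hgood heq hR (pout_nonneg hb hy hq0 hq.1) hq.2.1 hq.2.2
      fun n => limsupLE_pout_sub hb hy hq0 n

end Optimality

/-! ### Ergodic averages of rates and powers -/

section Averages

variable {Ω : Type*} [MeasurableSpace Ω] {ℙ : Measure Ω}
  {x y : ℕ → Ω → Fin N → ℝ}

theorem integrable_power [IsProbabilityMeasure ℙ]
    (s : System N) (hx : IsFading ℙ x) {lam : Fin N → ℝ}
    (hlam : ∀ n, 0 < lam n) (n : Fin N) :
    Integrable (fun ω => power s.μ lam (x 0 ω) n) ℙ := by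
  refine Integrable.mono' (integrable_const (s.μ n / lam n))
    ((measurable_power s.μ lam n).comp (hx.stationaryErgodic.1 0)).aestronglyMeasurable ?_
  filter_upwards [hx.ae_goodGain_zero hlam] with ω hω
  rw [Real.norm_eq_abs, abs_of_nonneg (power_nonneg (fun k => (hω.1 k).le) n)]
  exact power_le s.μ_pos hlam hω n

theorem integrable_rate_power (s : System N) (hx : IsFading ℙ x) {lam : Fin N → ℝ}
    (hlam : ∀ n, 0 < lam n) (n : Fin N) :
    Integrable (fun ω => rate (x 0 ω) (power s.μ lam (x 0 ω)) n) ℙ := by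
  refine Integrable.mono' (((hx.integrable n).const_mul (s.μ n / lam n)).const_mul (Real.log 2)⁻¹)
    ((measurable_rate_comp (measurable_power s.μ lam) n).comp
      (hx.stationaryErgodic.1 0)).aestronglyMeasurable ?_
  filter_upwards [hx.ae_goodGain_zero hlam] with ω hω
  have hg : ∀ k, 0 ≤ x 0 ω k := fun k => (hω.1 k).le
  have hP := power_nonneg (μ := s.μ) (lam := lam) hg
  rw [Real.norm_eq_abs, abs_of_nonneg (rate_nonneg hg hP n), ← div_eq_inv_mul,
    le_div_iff₀ (Real.log_pos one_lt_two), mul_comm]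
  exact (log_two_mul_rate_le hg hP n).trans
    (mul_le_mul_of_nonneg_right (power_le s.μ_pos hlam hω n) (hg n))

/-- The averages above level `K` converge to the mean of the gain above `K`, which tends to 0 by
integrability. Natural levels keep the exceptional sets countable in number. -/
theorem IsFading.ae_smallTails [IsProbabilityMeasure ℙ]
    (hx : IsFading ℙ x) : ∀ᵐ ω ∂ℙ, SmallTails fun i => x i ω := by
  have hmeas : ∀ (K : ℕ) (n : Fin N),
      Measurable fun g : Fin N → ℝ => if (K : ℝ) < g n then g n else 0 := fun K n =>
    Measurable.ite (measurableSet_lt measurable_const (measurable_pi_apply n))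
      (measurable_pi_apply n) measurable_const
  have hle : ∀ (K : ℕ) (n : Fin N) (ω : Ω),
      ‖if (K : ℝ) < x 0 ω n then x 0 ω n else 0‖ ≤ x 0 ω n := by
    intro K n ω
    split_ifs
    · rw [Real.norm_eq_abs, abs_of_nonneg (hx.nonneg 0 ω n)]
    · rw [norm_zero]; exact hx.nonneg 0 ω n
  have hm : ∀ (K : ℕ) (n : Fin N), AEStronglyMeasurable
      (fun ω => if (K : ℝ) < x 0 ω n then x 0 ω n else 0) ℙ := fun K n =>
    ((hmeas K n).comp (hx.stationaryErgodic.1 0)).aestronglyMeasurable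
  have havg := ae_all_iff.2 fun K : ℕ => ae_all_iff.2 fun n : Fin N =>
    hx.stationaryErgodic.ae_tendsto_avg (hmeas K n)
      ((hx.integrable n).mono' (hm K n) (Eventually.of_forall (hle K n)))
  have hlim : ∀ n, Tendsto (fun K : ℕ => ∫ ω, (if (K : ℝ) < x 0 ω n then x 0 ω n else 0) ∂ℙ)
      atTop (𝓝 0) := by
    intro n
    have := tendsto_integral_of_dominated_convergence (μ := ℙ)
      (F := fun (K : ℕ) ω => if (K : ℝ) < x 0 ω n then x 0 ω n else 0) (f := fun _ => 0)
      (fun ω => x 0 ω n) (fun K => hm K n) (hx.integrable n)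
      (fun K => Eventually.of_forall (hle K n)) (Eventually.of_forall fun ω => ?_)
    · simpa using this
    · obtain ⟨K, hK⟩ := exists_nat_ge (x 0 ω n)
      refine tendsto_const_nhds.congr' ?_
      filter_upwards [eventually_ge_atTop K] with L hL
      rw [if_neg (not_lt.2 (hK.trans (Nat.cast_le.2 hL)))]
  filter_upwards [havg] with ω hω n δ hδ
  obtain ⟨K, hK⟩ := ((hlim n).eventually (gt_mem_nhds hδ)).exists
  exact ⟨K, (hω K n).eventually (ge_mem_nhds hK)⟩

theorem ae_tendsto_avg_rate [IsProbabilityMeasure ℙ]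
    (s : System N) (hx : IsFading ℙ x) {lam : Fin N → ℝ}
    (hlam : ∀ n, 0 < lam n) : ∀ᵐ ω ∂ℙ, ∀ n,
      Tendsto (avg fun i => rate (x i ω) (ehuPower s.μ lam (x i ω)) n) atTop
        (𝓝 (∫ ω, rate (x 0 ω) (power s.μ lam (x 0 ω)) n ∂ℙ)) := by
  have h := ae_all_iff.2 fun n => hx.stationaryErgodic.ae_tendsto_avg
    (measurable_rate_comp (measurable_power s.μ lam) n) (integrable_rate_power s hx hlam n)
  filter_upwards [h, hx.ae_goodGain hlam] with ω hω hgood n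
  simp only [ehuPower_eq_power s.μ_antitone hlam (hgood _)]
  exact hω n

theorem measurable_bsPower (s : System N) (lam : Fin N → ℝ) (lam0 : ℝ) :
    Measurable (bsPower s lam lam0) := by
  unfold bsPower
  exact Measurable.ite (measurableSet_le measurable_const (Finset.measurable_fun_sum _ fun n _ =>
    (measurable_pi_apply n).const_mul _)) measurable_const measurable_const

theorem integrable_bsPower [IsProbabilityMeasure ℙ]
    (s : System N) (hy : IsFading ℙ y) (lam : Fin N → ℝ) (lam0 : ℝ) :
    Integrable (fun ω => bsPower s lam lam0 (y 0 ω)) ℙ := by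
  refine Integrable.mono' (integrable_const s.Pmax)
    ((measurable_bsPower s lam lam0).comp (hy.stationaryErgodic.1 0)).aestronglyMeasurable
    (Eventually.of_forall fun ω => ?_)
  rw [Real.norm_eq_abs, abs_of_nonneg (bsPower_mem s lam lam0 _).1]
  exact (bsPower_mem s lam lam0 _).2

theorem norm_bsPower_mul_le (s : System N) (hy : IsFading ℙ y) (lam : Fin N → ℝ) (lam0 : ℝ)
    (n : Fin N) (ω : Ω) : ‖bsPower s lam lam0 (y 0 ω) * y 0 ω n‖ ≤ s.Pmax * y 0 ω n := by
  have h := bsPower_mem s lam lam0 (y 0 ω)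
  rw [Real.norm_eq_abs, abs_of_nonneg (mul_nonneg h.1 (hy.nonneg 0 ω n))]
  exact mul_le_mul_of_nonneg_right h.2 (hy.nonneg 0 ω n)

theorem measurable_bsPower_mul (s : System N) (lam : Fin N → ℝ) (lam0 : ℝ) (n : Fin N) :
    Measurable fun h : Fin N → ℝ => bsPower s lam lam0 h * h n :=
  (measurable_bsPower s lam lam0).mul (measurable_pi_apply n)

theorem integrable_bsPower_mul (s : System N) (hy : IsFading ℙ y) (lam : Fin N → ℝ) (lam0 : ℝ)
    (n : Fin N) : Integrable (fun ω => bsPower s lam lam0 (y 0 ω) * y 0 ω n) ℙ :=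
  Integrable.mono' ((hy.integrable n).const_mul s.Pmax)
    ((measurable_bsPower_mul s lam lam0 n).comp (hy.stationaryErgodic.1 0)).aestronglyMeasurable
    (Eventually.of_forall fun ω => norm_bsPower_mul_le s hy lam lam0 n ω)

/-- The multiplier equations hold almost surely when they hold in the mean. -/
theorem ae_multiplierEquations [IsProbabilityMeasure ℙ]
    (s : System N) (hx : IsFading ℙ x) (hy : IsFading ℙ y)
    {lam : Fin N → ℝ} {lam0 : ℝ} (hlam : ∀ n, 0 < lam n)
    (h1 : ∀ n, ∫ ω, power s.μ lam (x 0 ω) n ∂ℙ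
      = s.η' * ∫ ω, bsPower s lam lam0 (y 0 ω) * y 0 ω n ∂ℙ)
    (h2 : ∫ ω, bsPower s lam lam0 (y 0 ω) ∂ℙ = s.Pavg) :
    ∀ᵐ ω ∂ℙ, MultiplierEquations s lam lam0 (fun i => x i ω) (fun i => y i ω) := by
  have hp := ae_all_iff.2 fun n => hx.stationaryErgodic.ae_tendsto_avg
    (measurable_power s.μ lam n) (integrable_power s hx hlam n)
  have hb := ae_all_iff.2 fun n => hy.stationaryErgodic.ae_tendsto_avg
    (measurable_bsPower_mul s lam lam0 n) (integrable_bsPower_mul s hy lam lam0 n)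
  have h0 := hy.stationaryErgodic.ae_tendsto_avg
    (measurable_bsPower s lam lam0) (integrable_bsPower s hy lam lam0)
  filter_upwards [hp, hb, h0, hx.ae_goodGain hlam] with ω hpω hbω h0ω hgood
  refine ⟨fun n => ?_, by rw [h2] at h0ω; exact h0ω⟩
  have h3 := (hpω n).sub ((hbω n).const_mul s.η')
  rw [h1 n, sub_self] at h3
  refine h3.congr fun M => ?_
  rw [← avg_const_mul]
  simp only [starPolicy, ehuPower_eq_power s.μ_antitone hlam (hgood _), mul_assoc]

end Averages

/-! ### Continuity of the powers in the multipliers -/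

/-- For almost every level, winning and not winning both persist under small changes of the prices,
so the indicators converge almost everywhere. Prices above half their limits confine the winning
sets to one bounded interval, which gives domination. -/
theorem continuousAt_volume_winSet {μ c : Fin N → ℝ} (hc : ∀ n, 0 < c n)
    (hci : Function.Injective c) (n : Fin N) :
    ContinuousAt (fun c => volume.real (winSet μ c n)) c := by
  have hcont : ∀ (k : Fin N) (t : ℝ), ContinuousAt (fun c : Fin N → ℝ => μ k / t - c k) c :=
    fun k t => (continuous_const.sub (continuous_apply k)).continuousAt
  simp_rw [← fun c : Fin N → ℝ => integral_indicator_one (μ := volume) (measurableSet_winSet μ c n)]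
  have hev : ∀ᶠ c' in 𝓝 c, ∀ k, c k / 2 < c' k := eventually_all.2 fun k =>
    (continuous_apply k).continuousAt.eventually (lt_mem_nhds (half_lt_self (hc k)))
  refine tendsto_integral_filter_of_dominated_convergence
    (Set.indicator (Set.Ioo 1 (|μ n| / (c n / 2))) 1)
    (Eventually.of_forall fun c' => (measurable_one.indicator
      (measurableSet_winSet μ c' n)).aestronglyMeasurable) ?_ ?_ ?_
  · filter_upwards [hev] with c' hc'
    refine Eventually.of_forall fun t => ?_
    have hpos : ∀ k, 0 < c' k := fun k => (half_pos (hc k)).trans (hc' k)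
    have hsub : winSet μ c' n ⊆ Set.Ioo 1 (|μ n| / (c n / 2)) :=
      (winSet_subset hpos n).trans (Set.Ioo_subset_Ioo_right
        (div_le_div₀ (abs_nonneg _) (le_abs_self _) (half_pos (hc n)) (hc' n).le))
    rw [Real.norm_eq_abs, abs_of_nonneg (Set.indicator_nonneg (f := 1) (fun _ _ => zero_le_one) _)]
    exact Set.indicator_le_indicator_of_subset hsub (fun _ => zero_le_one) t
  · exact (integrable_indicator_iff measurableSet_Ioo).2
      (integrableOn_const (by simp) (by simp))
  · have htie : ∀ᵐ t : ℝ, t ∉ tieSet μ c :=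
      measure_eq_zero_iff_ae_notMem.1 ((tieSet_finite _ _).measure_zero volume)
    -- At this single level the marginal of `n` vanishes, and an arbitrarily small change of price
    -- could make it positive.
    have hzero : ∀ᵐ t : ℝ, t ≠ μ n / c n := by
      simpa using measure_eq_zero_iff_ae_notMem.1 (measure_singleton (μ := volume) (μ n / c n))
    filter_upwards [htie, hzero] with t ht ht0
    refine tendsto_const_nhds.congr' ?_
    by_cases hmem : t ∈ winSet μ c n
    · have h1 : ∀ᶠ c' in 𝓝 c, 0 < μ n / t - c' n := (hcont n t).eventually (lt_mem_nhds hmem.2.1)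
      have h2 : ∀ᶠ c' in 𝓝 c, ∀ k, k ≠ n → μ k / t - c' k < μ n / t - c' n := by
        refine eventually_all.2 fun k => ?_
        by_cases hk : k = n
        · exact Eventually.of_forall fun _ h => absurd hk h
        · filter_upwards [(hcont k t).eventually_lt (hcont n t) (hmem.2.2 k hk)] with c' h _ using h
      filter_upwards [h1, h2] with c' h3 h4
      have hmem' : t ∈ winSet μ c' n := ⟨hmem.1, h3, h4⟩
      rw [Set.indicator_of_mem hmem, Set.indicator_of_mem hmem']
    · have hout : ∀ᶠ c' in 𝓝 c, t ∉ winSet μ c' n := by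
        rcases le_or_gt t 1 with h1 | h1
        · exact Eventually.of_forall fun c' h => h1.not_gt h.1
        rcases exists_mem_winSet_or hci h1 ht with ⟨j, hj⟩ | h
        · have hne : n ≠ j := fun h => hmem (h ▸ hj)
          filter_upwards [(hcont n t).eventually_lt (hcont j t) (hj.2.2 n hne)] with c' h2 h3
          exact lt_asymm h2 (h3.2.2 j hne.symm)
        · have hlt : μ n / t - c n < 0 := (h n).lt_of_ne fun h2 => ht0 (by
            have ht' : t ≠ 0 := (zero_lt_one.trans h1).ne'
            rw [sub_eq_zero, div_eq_iff ht'] at h2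
            rw [h2, mul_div_cancel_left₀ _ (hc n).ne'])
          filter_upwards [(hcont n t).eventually (gt_mem_nhds hlt)] with c' h2 h3
          exact lt_asymm h2 h3.2.1
      filter_upwards [hout] with c' hc'
      rw [Set.indicator_of_notMem hmem, Set.indicator_of_notMem hc']

theorem continuousAt_power {μ lam g : Fin N → ℝ} (hlam : ∀ n, 0 < lam n) (hg : GoodGain lam g)
    (n : Fin N) : ContinuousAt (fun lam => power μ lam g n) lam := by
  have h1 : ContinuousAt (fun (lam : Fin N → ℝ) k => lam k / g k) lam :=
    (continuous_pi fun k => (continuous_apply k).div_const _).continuousAt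
  exact (ContinuousAt.comp (f := fun (lam : Fin N → ℝ) k => lam k / g k)
    (continuousAt_volume_winSet (hg.price_pos hlam) hg.2 n) h1).div_const _

section Dual

variable {Ω : Type*} [MeasurableSpace Ω] {ℙ : Measure Ω}
  {x y : ℕ → Ω → Fin N → ℝ}

theorem continuousAt_integral_power [IsProbabilityMeasure ℙ]
    (s : System N) (hx : IsFading ℙ x) {lam : Fin N → ℝ}
    (hlam : ∀ n, 0 < lam n) (n : Fin N) :
    ContinuousAt (fun lam => ∫ ω, power s.μ lam (x 0 ω) n ∂ℙ) lam := by
  have hev : ∀ᶠ lam' in 𝓝 lam, ∀ k, lam k / 2 < lam' k := eventually_all.2 fun k =>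
    (continuous_apply k).continuousAt.eventually (lt_mem_nhds (half_lt_self (hlam k)))
  refine tendsto_integral_filter_of_dominated_convergence (fun _ => s.μ n / (lam n / 2))
    (Eventually.of_forall fun lam' => ((measurable_power s.μ lam' n).comp
      (hx.stationaryErgodic.1 0)).aestronglyMeasurable) ?_ (integrable_const _) ?_
  · filter_upwards [hev] with lam' hlam'
    have hpos : ∀ k, 0 < lam' k := fun k => (half_pos (hlam k)).trans (hlam' k)
    filter_upwards [hx.ae_goodGain_zero hpos] with ω hω
    rw [Real.norm_eq_abs, abs_of_nonneg (power_nonneg (fun k => (hω.1 k).le) n)]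
    exact (power_le s.μ_pos hpos hω n).trans
      (div_le_div_of_nonneg_left (s.μ_pos n).le (half_pos (hlam n)) (hlam' n).le)
  · filter_upwards [hx.ae_goodGain_zero hlam] with ω hω
    exact continuousAt_power hlam hω n

theorem System.nonempty (s : System N) : Nonempty (Fin N) := by
  by_contra h
  rw [not_nonempty_iff] at h
  have := s.μ_sum
  simp at this

/-- The BS switches only when the downlink gains lie on a hyperplane, an event of probability zero;
off it the decision is locally constant in the multipliers. -/
theorem ae_eventually_bsPower_eq (s : System N) (hy : IsFading ℙ y)
    {θ : (Fin N → ℝ) × ℝ} (hθ : ∀ n, 0 < θ.1 n) :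
    ∀ᵐ ω ∂ℙ, ∀ᶠ θ' : (Fin N → ℝ) × ℝ in 𝓝 θ,
      bsPower s θ.1 θ.2 (y 0 ω) = bsPower s θ'.1 θ'.2 (y 0 ω) := by
  have hne : θ.1 ≠ 0 := by
    obtain ⟨n⟩ := s.nonempty
    exact fun h => (hθ n).ne' (congrFun h n)
  filter_upwards [measure_eq_zero_iff_ae_notMem.1 (hy.hyperplane θ.1 hne (θ.2 / s.η'))] with ω hω
  have h1 : ContinuousAt (fun θ : (Fin N → ℝ) × ℝ => ∑ n, θ.1 n * y 0 ω n) θ := by fun_prop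
  have h2 : ContinuousAt (fun θ : (Fin N → ℝ) × ℝ => θ.2 / s.η') θ := by fun_prop
  rcases lt_or_gt_of_ne hω with h | h
  · filter_upwards [h1.eventually_lt h2 h] with θ' h'
    rw [bsPower, bsPower, if_neg (not_le.2 h), if_neg (not_le.2 h')]
  · filter_upwards [h2.eventually_lt h1 h] with θ' h'
    rw [bsPower, bsPower, if_pos (le_of_lt h), if_pos h'.le]

theorem continuousAt_integral_bsPower [IsProbabilityMeasure ℙ] (s : System N) (hy : IsFading ℙ y)
    {θ : (Fin N → ℝ) × ℝ} (hθ : ∀ n, 0 < θ.1 n) :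
    ContinuousAt (fun θ : (Fin N → ℝ) × ℝ => ∫ ω, bsPower s θ.1 θ.2 (y 0 ω) ∂ℙ) θ := by
  refine tendsto_integral_filter_of_dominated_convergence (fun _ => s.Pmax)
    (Eventually.of_forall fun θ' => (integrable_bsPower s hy θ'.1 θ'.2).aestronglyMeasurable)
    (Eventually.of_forall fun θ' => Eventually.of_forall fun ω => ?_) (integrable_const _) ?_
  · rw [Real.norm_eq_abs, abs_of_nonneg (bsPower_mem s _ _ _).1]
    exact (bsPower_mem s _ _ _).2
  · filter_upwards [ae_eventually_bsPower_eq s hy hθ] with ω hω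
    exact tendsto_const_nhds.congr' hω

theorem continuousAt_integral_bsPower_mul [IsProbabilityMeasure ℙ]
    (s : System N) (hy : IsFading ℙ y)
    {θ : (Fin N → ℝ) × ℝ} (hθ : ∀ n, 0 < θ.1 n) (n : Fin N) :
    ContinuousAt (fun θ : (Fin N → ℝ) × ℝ => ∫ ω, bsPower s θ.1 θ.2 (y 0 ω) * y 0 ω n ∂ℙ) θ := by
  refine tendsto_integral_filter_of_dominated_convergence (fun ω => s.Pmax * y 0 ω n)
    (Eventually.of_forall fun θ' => (integrable_bsPower_mul s hy θ'.1 θ'.2 n).aestronglyMeasurable)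
    (Eventually.of_forall fun θ' => Eventually.of_forall fun ω =>
      norm_bsPower_mul_le s hy θ'.1 θ'.2 n ω) ((hy.integrable n).const_mul _) ?_
  filter_upwards [ae_eventually_bsPower_eq s hy hθ] with ω hω
  refine tendsto_const_nhds.congr' (hω.mono fun θ' h => ?_)
  rw [h]

/-! ### The dual function -/

/-- Net value of the harvested energy in a slot with downlink gains `h`. -/
noncomputable def bsValue (s : System N) (θ : (Fin N → ℝ) × ℝ) (h : Fin N → ℝ) : ℝ :=
  bsPower s θ.1 θ.2 h * (s.η' * ∑ n, θ.1 n * h n - θ.2)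

/-- The dual function of the problem without batteries. -/
noncomputable def dual (s : System N) (ℙ : Measure Ω) (x y : ℕ → Ω → Fin N → ℝ)
    (θ : (Fin N → ℝ) × ℝ) : ℝ :=
  ∫ ω, lagrangian s.μ θ.1 (x 0 ω) (power s.μ θ.1 (x 0 ω)) ∂ℙ
    + ∫ ω, bsValue s θ (y 0 ω) ∂ℙ + θ.2 * s.Pavg

/-- Mean harvested power of user `n`, less its mean transmit power. -/
noncomputable def energyGap (s : System N) (ℙ : Measure Ω) (x y : ℕ → Ω → Fin N → ℝ)
    (θ : (Fin N → ℝ) × ℝ) (n : Fin N) : ℝ :=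
  s.η' * ∫ ω, bsPower s θ.1 θ.2 (y 0 ω) * y 0 ω n ∂ℙ - ∫ ω, power s.μ θ.1 (x 0 ω) n ∂ℙ

/-- Unused part of the average power of the BS. -/
noncomputable def powerGap (s : System N) (ℙ : Measure Ω) (y : ℕ → Ω → Fin N → ℝ)
    (θ : (Fin N → ℝ) × ℝ) : ℝ :=
  s.Pavg - ∫ ω, bsPower s θ.1 θ.2 (y 0 ω) ∂ℙ

theorem bsValue_eq (s : System N) (θ : (Fin N → ℝ) × ℝ) (h : Fin N → ℝ) :
    bsValue s θ h = ∑ n, s.η' * θ.1 n * (bsPower s θ.1 θ.2 h * h n)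
      - θ.2 * bsPower s θ.1 θ.2 h := by
  unfold bsValue
  rw [mul_sub, Finset.mul_sum, Finset.mul_sum, mul_comm _ θ.2]
  congr 1
  exact Finset.sum_congr rfl fun n _ => by ring

theorem integrable_bsValue [IsProbabilityMeasure ℙ]
    (s : System N) (hy : IsFading ℙ y) (θ : (Fin N → ℝ) × ℝ) :
    Integrable (fun ω => bsValue s θ (y 0 ω)) ℙ := by
  simp_rw [bsValue_eq]
  exact (integrable_finsetSum _ fun n _ => (integrable_bsPower_mul s hy _ _ n).const_mul _).sub
    ((integrable_bsPower s hy _ _).const_mul _)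

theorem integrable_lagrangian [IsProbabilityMeasure ℙ]
    (s : System N) (hx : IsFading ℙ x) {lam : Fin N → ℝ}
    (hlam : ∀ n, 0 < lam n) :
    Integrable (fun ω => lagrangian s.μ lam (x 0 ω) (power s.μ lam (x 0 ω))) ℙ := by
  unfold lagrangian
  exact integrable_finsetSum _ fun n _ =>
    (((integrable_rate_power s hx hlam n).const_mul _).const_mul _).sub
      ((integrable_power s hx hlam n).const_mul _)

/-- The powers chosen for `lam` compete in the maximization for `lam'`, where their Lagrangian
differs by a linear term. -/
theorem integral_lagrangian_ge [IsProbabilityMeasure ℙ]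
    (s : System N) (hx : IsFading ℙ x) {lam lam' : Fin N → ℝ}
    (hlam : ∀ n, 0 < lam n) (hlam' : ∀ n, 0 < lam' n) :
    ∫ ω, lagrangian s.μ lam (x 0 ω) (power s.μ lam (x 0 ω)) ∂ℙ
      - ∑ n, (lam' n - lam n) * ∫ ω, power s.μ lam (x 0 ω) n ∂ℙ
      ≤ ∫ ω, lagrangian s.μ lam' (x 0 ω) (power s.μ lam' (x 0 ω)) ∂ℙ := by
  have hi : ∀ n, Integrable (fun ω => (lam' n - lam n) * power s.μ lam (x 0 ω) n) ℙ := fun n =>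
    (integrable_power s hx hlam n).const_mul _
  simp_rw [← integral_const_mul]
  rw [← integral_finsetSum _ fun n _ => hi n,
    ← integral_sub (integrable_lagrangian s hx hlam) (integrable_finsetSum _ fun n _ => hi n)]
  refine integral_mono_ae ((integrable_lagrangian s hx hlam).sub
    (integrable_finsetSum _ fun n _ => hi n)) (integrable_lagrangian s hx hlam') ?_
  filter_upwards [hx.ae_goodGain_zero hlam'] with ω hω
  rw [← lagrangian_sub]
  exact lagrangian_le s.μ_antitone hlam' hω (power_nonneg fun n => (hω.1 n).le)

theorem integral_bsValue_ge [IsProbabilityMeasure ℙ]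
    (s : System N) (hy : IsFading ℙ y) (θ θ' : (Fin N → ℝ) × ℝ) :
    ∫ ω, bsValue s θ (y 0 ω) ∂ℙ
      + ∑ n, (θ'.1 n - θ.1 n) * (s.η' * ∫ ω, bsPower s θ.1 θ.2 (y 0 ω) * y 0 ω n ∂ℙ)
      - (θ'.2 - θ.2) * ∫ ω, bsPower s θ.1 θ.2 (y 0 ω) ∂ℙ
      ≤ ∫ ω, bsValue s θ' (y 0 ω) ∂ℙ := by
  have hi : ∀ n, Integrable
      (fun ω => (θ'.1 n - θ.1 n) * (s.η' * (bsPower s θ.1 θ.2 (y 0 ω) * y 0 ω n))) ℙ := fun n =>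
    ((integrable_bsPower_mul s hy _ _ n).const_mul _).const_mul _
  have hS := integrable_finsetSum Finset.univ fun n _ => hi n
  have hB := (integrable_bsPower s hy θ.1 θ.2).const_mul (θ'.2 - θ.2)
  have hV := integrable_bsValue s hy θ
  have hVS : Integrable (fun ω => bsValue s θ (y 0 ω) + ∑ n, (θ'.1 n - θ.1 n) *
      (s.η' * (bsPower s θ.1 θ.2 (y 0 ω) * y 0 ω n))) ℙ := hV.add hS
  simp_rw [← integral_const_mul]
  rw [← integral_finsetSum _ fun n _ => hi n, ← integral_add hV hS,
    ← integral_sub hVS hB]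
  refine integral_mono (hVS.sub hB) (integrable_bsValue s hy θ') fun ω => ?_
  have h1 := mul_le_bsPower_mul s θ'.1 θ'.2 (y 0 ω) (bsPower_mem s θ.1 θ.2 (y 0 ω)).1
    (bsPower_mem s θ.1 θ.2 (y 0 ω)).2
  refine le_trans (le_of_eq ?_) h1
  have h2 : ∑ n, (θ'.1 n - θ.1 n) * (s.η' * (bsPower s θ.1 θ.2 (y 0 ω) * y 0 ω n))
      = bsPower s θ.1 θ.2 (y 0 ω) * (s.η' * ∑ n, θ'.1 n * y 0 ω n)
        - bsPower s θ.1 θ.2 (y 0 ω) * (s.η' * ∑ n, θ.1 n * y 0 ω n) := by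
    simp only [Finset.mul_sum]
    rw [← Finset.sum_sub_distrib]
    exact Finset.sum_congr rfl fun n _ => by ring
  simp only [bsValue]
  rw [h2]
  ring

/-- The gaps form a subgradient of the dual function. -/
theorem dual_ge [IsProbabilityMeasure ℙ] (s : System N) (hx : IsFading ℙ x) (hy : IsFading ℙ y)
    {θ θ' : (Fin N → ℝ) × ℝ} (hθ : ∀ n, 0 < θ.1 n) (hθ' : ∀ n, 0 < θ'.1 n) :
    dual s ℙ x y θ + ∑ n, (θ'.1 n - θ.1 n) * energyGap s ℙ x y θ n
      + (θ'.2 - θ.2) * powerGap s ℙ y θ ≤ dual s ℙ x y θ' := by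
  have h1 := integral_lagrangian_ge s hx hθ hθ'
  have h2 := integral_bsValue_ge s hy θ θ'
  unfold dual energyGap powerGap
  simp only [mul_sub, Finset.sum_sub_distrib] at h1 h2 ⊢
  linarith

/-! ### Coercivity of the dual function -/

theorem lagrangian_power_nonneg {μ lam g : Fin N → ℝ} (hμ : Antitone μ) (hlam : ∀ n, 0 < lam n)
    (hg : GoodGain lam g) : 0 ≤ lagrangian μ lam g (power μ lam g) := by
  have h1 := lagrangian_le hμ hlam hg (P := 0) fun n => le_rfl
  have h2 : lagrangian μ lam g 0 = 0 := by simp [lagrangian, rate]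
  rwa [h2] at h1

/-- Test power: user `n` alone transmits `1 / lam n`, at cost exactly 1. The gain in value blows up
as `lam n` tends to 0. -/
theorem log_le_lagrangian_power {μ lam g : Fin N → ℝ} (hμ : Antitone μ) (hlam : ∀ n, 0 < lam n)
    (hg : GoodGain lam g) (n : Fin N) :
    μ n * Real.log (1 + g n / lam n) ≤ lagrangian μ lam g (power μ lam g) + 1 := by
  have hP : ∀ k, 0 ≤ (Pi.single n (1 / lam n) : Fin N → ℝ) k := by
    intro k
    rcases eq_or_ne k n with rfl | hk
    · simpa using (hlam k).le
    · simp [hk]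
  have h1 := lagrangian_le hμ hlam hg hP
  have h2 : lagrangian μ lam g (Pi.single n (1 / lam n))
      = μ n * Real.log (1 + g n / lam n) - 1 := by
    have h3 : ∑ k ∈ Finset.univ.filter (· < n),
        (Pi.single n (1 / lam n) : Fin N → ℝ) k * g k = 0 := by
      refine Finset.sum_eq_zero fun k hk => ?_
      rw [Pi.single_eq_of_ne (Finset.mem_filter.1 hk).2.ne, zero_mul]
    unfold lagrangian
    rw [Finset.sum_eq_single n]
    · rw [Pi.single_eq_same, mul_one_div_cancel (hlam n).ne', rate, h3, Pi.single_eq_same, add_zero,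
        div_one, Real.logb, mul_div_cancel₀ _ (Real.log_pos one_lt_two).ne', one_div_mul_eq_div]
    · intro k _ hk
      simp [rate, hk]
    · simp
  linarith

theorem IsFading.exists_level [IsProbabilityMeasure ℙ] (h : IsFading ℙ x) (n : Fin N) :
    ∃ κ > 0, 0 < ℙ.real {ω | κ ≤ x 0 ω n} := by
  by_contra! hcon
  have h1 : ∀ k : ℕ, ∀ᵐ ω ∂ℙ, x 0 ω n < 1 / ((k : ℝ) + 1) := by
    intro k
    have h2 := (hcon (1 / ((k : ℝ) + 1)) (by positivity)).antisymm measureReal_nonneg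
    rw [measureReal_eq_zero_iff, measure_eq_zero_iff_ae_notMem] at h2
    filter_upwards [h2] with ω hω using not_le.1 hω
  obtain ⟨ω, h3, h4⟩ := ((ae_all_iff.2 h1).and (h.ae_pos n)).exists
  obtain ⟨k, hk⟩ := exists_nat_one_div_lt h4
  exact lt_asymm hk (h3 k)

theorem IsFading.integral_pos [IsProbabilityMeasure ℙ]
    (h : IsFading ℙ x) (n : Fin N) : 0 < ∫ ω, x 0 ω n ∂ℙ := by
  obtain ⟨κ, hκ, h1⟩ := h.exists_level n
  exact (mul_pos hκ h1).trans_le (mul_meas_ge_le_integral_of_nonneg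
    (Eventually.of_forall fun ω => h.nonneg 0 ω n) (h.integrable n) κ)

/-- Multipliers with a bounded dual value are bounded below. -/
theorem exists_pos_le_of_integral_lagrangian_le [IsProbabilityMeasure ℙ]
    (s : System N) (hx : IsFading ℙ x) (n : Fin N)
    (G : ℝ) : ∃ δ > 0, ∀ lam : Fin N → ℝ, (∀ n, 0 < lam n) →
      ∫ ω, lagrangian s.μ lam (x 0 ω) (power s.μ lam (x 0 ω)) ∂ℙ ≤ G → δ ≤ lam n := by
  obtain ⟨κ, hκ, hπ⟩ := hx.exists_level n
  set π := ℙ.real {ω | κ ≤ x 0 ω n}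
  -- The bound comes from solving `π * μ n * log (1 + κ / lam n) ≤ G + 1` for `lam n`. That
  -- inequality is Markov's, applied to the Lagrangian plus 1 on the event that the gain is at least
  -- `κ`.
  refine ⟨κ / Real.exp ((G + 1) / (π * s.μ n)), by positivity, fun lam hlam hG => ?_⟩
  have hi := integrable_lagrangian s hx hlam
  have h1 := mul_meas_ge_le_integral_of_nonneg (μ := ℙ)
    (f := fun ω => lagrangian s.μ lam (x 0 ω) (power s.μ lam (x 0 ω)) + 1)
    (by
      filter_upwards [hx.ae_goodGain_zero hlam] with ω hω
      have := lagrangian_power_nonneg s.μ_antitone hlam hω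
      simp only [Pi.zero_apply]
      linarith) (hi.add (integrable_const 1)) (s.μ n * Real.log (1 + κ / lam n))
  have h2 : π ≤ ℙ.real {ω | s.μ n * Real.log (1 + κ / lam n) ≤
      lagrangian s.μ lam (x 0 ω) (power s.μ lam (x 0 ω)) + 1} := by
    refine ENNReal.toReal_mono (measure_ne_top _ _) (measure_mono_ae ?_)
    filter_upwards [hx.ae_goodGain_zero hlam] with ω hω hκω
    refine le_trans ?_ (log_le_lagrangian_power s.μ_antitone hlam hω n)
    refine mul_le_mul_of_nonneg_left (Real.log_le_log ?_ ?_) (s.μ_pos n).le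
    · have := div_pos hκ (hlam n)
      linarith
    · have := div_le_div_of_nonneg_right hκω (hlam n).le
      linarith
  rw [integral_add hi (integrable_const 1)] at h1
  simp only [integral_const, probReal_univ, one_smul] at h1
  have hκl := div_pos hκ (hlam n)
  have hlog : 0 ≤ Real.log (1 + κ / lam n) := Real.log_nonneg (by linarith)
  have h3 : s.μ n * Real.log (1 + κ / lam n) * π ≤ G + 1 :=
    (mul_le_mul_of_nonneg_left h2 (mul_nonneg (s.μ_pos n).le hlog)).trans (h1.trans (by linarith))
  have h4 : Real.log (1 + κ / lam n) ≤ (G + 1) / (π * s.μ n) := by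
    rw [le_div_iff₀ (mul_pos hπ (s.μ_pos n))]
    linarith
  rw [Real.log_le_iff_le_exp (by linarith)] at h4
  rw [div_le_iff₀ (Real.exp_pos _)]
  have h5 : κ / lam n ≤ Real.exp ((G + 1) / (π * s.μ n)) := by linarith
  rw [div_le_iff₀ (hlam n)] at h5
  linarith

theorem integral_lagrangian_nonneg (s : System N) (hx : IsFading ℙ x) {lam : Fin N → ℝ}
    (hlam : ∀ n, 0 < lam n) :
    0 ≤ ∫ ω, lagrangian s.μ lam (x 0 ω) (power s.μ lam (x 0 ω)) ∂ℙ := by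
  refine integral_nonneg_of_ae ?_
  filter_upwards [hx.ae_goodGain_zero hlam] with ω hω
  exact lagrangian_power_nonneg s.μ_antitone hlam hω

theorem bsValue_nonneg (s : System N) (θ : (Fin N → ℝ) × ℝ) (h : Fin N → ℝ) :
    0 ≤ bsValue s θ h := by
  have := mul_le_bsPower_mul s θ.1 θ.2 h le_rfl s.Pmax_pos.le
  rwa [zero_mul] at this

/-- Comparison with constant BS power `Pavg`. In the dual function the terms in `θ.2` then cancel,
and what remains bounds the user multipliers from above. -/
theorem integral_bsValue_ge_mean [IsProbabilityMeasure ℙ]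
    (s : System N) (hy : IsFading ℙ y) (θ : (Fin N → ℝ) × ℝ) :
    s.Pavg * (s.η' * ∑ n, θ.1 n * ∫ ω, y 0 ω n ∂ℙ - θ.2) ≤ ∫ ω, bsValue s θ (y 0 ω) ∂ℙ := by
  have hi : ∀ n, Integrable (fun ω => θ.1 n * y 0 ω n) ℙ := fun n => (hy.integrable n).const_mul _
  have hS := integrable_finsetSum Finset.univ fun n _ => hi n
  have h1 : s.Pavg * (s.η' * ∑ n, θ.1 n * ∫ ω, y 0 ω n ∂ℙ - θ.2)
      = ∫ ω, s.Pavg * (s.η' * ∑ n, θ.1 n * y 0 ω n - θ.2) ∂ℙ := by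
    rw [integral_const_mul, integral_sub (hS.const_mul _) (integrable_const _), integral_const_mul,
      integral_finsetSum _ fun n _ => hi n]
    simp [integral_const_mul]
  rw [h1]
  exact integral_mono (((hS.const_mul _).sub (integrable_const _)).const_mul _)
    (integrable_bsValue s hy θ)
    fun ω => mul_le_bsPower_mul s θ.1 θ.2 (y 0 ω) s.Pavg_pos.le s.Pavg_le

/-- A minimizer under `0 ≤ θ.2` is hence a minimizer over all real `θ.2`. This is why the average
power constraint holds with equality even when the BS multiplier is 0. -/
theorem dual_ge_of_neg [IsProbabilityMeasure ℙ] (s : System N) (hy : IsFading ℙ y)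
    {θ : (Fin N → ℝ) × ℝ} (hθ : ∀ n, 0 < θ.1 n) (hneg : θ.2 < 0) :
    dual s ℙ x y (θ.1, 0) ≤ dual s ℙ x y θ := by
  have h1 : ∫ ω, bsValue s (θ.1, 0) (y 0 ω) ∂ℙ + -θ.2 * s.Pmax ≤ ∫ ω, bsValue s θ (y 0 ω) ∂ℙ := by
    have h2 : -θ.2 * s.Pmax = ∫ _, -θ.2 * s.Pmax ∂ℙ := by simp
    rw [h2, ← integral_add (integrable_bsValue s hy _) (integrable_const _)]
    refine integral_mono ((integrable_bsValue s hy _).add (integrable_const _))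
      (integrable_bsValue s hy θ) fun ω => ?_
    have h3 := mul_le_bsPower_mul s θ.1 θ.2 (y 0 ω) s.Pmax_pos.le le_rfl
    have h4 : bsValue s (θ.1, 0) (y 0 ω) ≤ s.Pmax * (s.η' * ∑ n, θ.1 n * y 0 ω n - 0) :=
      mul_le_mul_of_nonneg_right (bsPower_mem s _ _ _).2 (by
        rw [sub_zero]
        exact mul_nonneg s.η'_pos.le (Finset.sum_nonneg fun n _ =>
          mul_nonneg (hθ n).le (hy.nonneg 0 ω n)))
    change _ ≤ bsPower s θ.1 θ.2 (y 0 ω) * (s.η' * ∑ n, θ.1 n * y 0 ω n - θ.2)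
    linarith
  unfold dual
  have h5 := mul_le_mul_of_nonneg_left s.Pavg_le (neg_pos.2 hneg).le
  simp only [zero_mul, add_zero]
  linarith

/-! ### Minimization of the dual function and solution of the multiplier equations -/

theorem lowerSemicontinuousOn_dual [IsProbabilityMeasure ℙ]
    (s : System N) (hx : IsFading ℙ x) (hy : IsFading ℙ y)
    {K : Set ((Fin N → ℝ) × ℝ)} (hK : ∀ θ ∈ K, ∀ n, 0 < θ.1 n) :
    LowerSemicontinuousOn (dual s ℙ x y) K := by
  intro θ hθ r hr
  -- The affine minorant at `θ` touches the dual function there, which is all that lower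
  -- semicontinuity needs.
  have h1 : ContinuousAt (fun θ' : (Fin N → ℝ) × ℝ =>
      dual s ℙ x y θ + ∑ n, (θ'.1 n - θ.1 n) * energyGap s ℙ x y θ n
        + (θ'.2 - θ.2) * powerGap s ℙ y θ) θ := by fun_prop
  have h2 := h1.eventually (lt_mem_nhds (by simpa using hr))
  filter_upwards [self_mem_nhdsWithin, nhdsWithin_le_nhds h2] with θ' hθ' h3
  exact h3.trans_le (dual_ge s hx hy (hK θ hθ) (hK θ' hθ'))

theorem exists_dual_min [IsProbabilityMeasure ℙ]
    (s : System N) (hx : IsFading ℙ x) (hy : IsFading ℙ y) :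
    ∃ θ : (Fin N → ℝ) × ℝ, (∀ n, 0 < θ.1 n) ∧ 0 ≤ θ.2 ∧
      ∀ θ' : (Fin N → ℝ) × ℝ, (∀ n, 0 < θ'.1 n) → dual s ℙ x y θ ≤ dual s ℙ x y θ' := by
  set θ₁ : (Fin N → ℝ) × ℝ := (1, 0) with hθ₁
  have hθ₁pos : ∀ n, 0 < θ₁.1 n := fun n => zero_lt_one
  set G := dual s ℙ x y θ₁ with hG
  choose δ hδ hδle using fun n => exists_pos_le_of_integral_lagrangian_le s hx n G
  set C : Fin N → ℝ := fun n => G / (s.Pavg * s.η' * ∫ ω, y 0 ω n ∂ℙ) with hC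
  -- Multipliers no worse than the reference point `θ₁` lie in a compact box: the user multipliers
  -- are at least `δ` by the logarithmic blow-up and at most `C` by the constant BS power, and `θ.2
  -- * Pavg` is itself a term of the dual value beside nonnegative ones.
  have hbound : ∀ θ : (Fin N → ℝ) × ℝ, (∀ n, 0 < θ.1 n) → 0 ≤ θ.2 → dual s ℙ x y θ ≤ G →
      θ ∈ Set.Icc (δ, (0 : ℝ)) (C, G / s.Pavg) := by
    intro θ hθ hθ0 hle
    have h1 := integral_lagrangian_nonneg s hx hθ
    have h2 : 0 ≤ ∫ ω, bsValue s θ (y 0 ω) ∂ℙ := integral_nonneg fun ω => bsValue_nonneg s θ _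
    have h3 := integral_bsValue_ge_mean s hy θ
    have h4 := mul_nonneg hθ0 s.Pavg_pos.le
    unfold dual at hle
    refine ⟨⟨fun n => hδle n θ.1 hθ (by linarith), hθ0⟩, fun n => ?_, ?_⟩
    · have h5 : θ.1 n * ∫ ω, y 0 ω n ∂ℙ ≤ ∑ n, θ.1 n * ∫ ω, y 0 ω n ∂ℙ :=
        Finset.single_le_sum (f := fun n => θ.1 n * ∫ ω, y 0 ω n ∂ℙ)
          (fun k _ => (mul_pos (hθ k) (hy.integral_pos k)).le) (Finset.mem_univ n)
      have h6 := mul_le_mul_of_nonneg_left h5 (mul_pos s.Pavg_pos s.η'_pos).le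
      change θ.1 n ≤ G / (s.Pavg * s.η' * ∫ ω, y 0 ω n ∂ℙ)
      rw [le_div_iff₀ (mul_pos (mul_pos s.Pavg_pos s.η'_pos) (hy.integral_pos n))]
      linarith
    · change θ.2 ≤ G / s.Pavg
      rw [le_div_iff₀ s.Pavg_pos]
      linarith
  have hθ₁K := hbound θ₁ hθ₁pos le_rfl le_rfl
  have hKpos : ∀ θ ∈ Set.Icc (δ, (0 : ℝ)) (C, G / s.Pavg), ∀ n, 0 < θ.1 n := fun θ hθ n =>
    (hδ n).trans_le (hθ.1.1 n)
  obtain ⟨θ, hθK, hmin⟩ := (lowerSemicontinuousOn_dual s hx hy hKpos).exists_isMinOn ⟨θ₁, hθ₁K⟩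
    isCompact_Icc
  have hnn : ∀ θ' : (Fin N → ℝ) × ℝ, (∀ n, 0 < θ'.1 n) → 0 ≤ θ'.2 →
      dual s ℙ x y θ ≤ dual s ℙ x y θ' := by
    intro θ' hθ' h0
    rcases le_or_gt (dual s ℙ x y θ') G with h | h
    · exact hmin (hbound θ' hθ' h0 h)
    · exact (hmin hθ₁K).trans h.le
  refine ⟨θ, hKpos θ hθK, hθK.1.2, fun θ' hθ' => ?_⟩
  rcases le_or_gt 0 θ'.2 with h | h
  · exact hnn θ' hθ' h
  · exact (hnn (θ'.1, 0) hθ' le_rfl).trans (dual_ge_of_neg s hy hθ' h)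

/-- Differentiability of the dual function is not needed. From the minimizer one moves against its
gap vector; the subgradient inequality based at the displaced point, together with minimality, makes
the inner product of the gap vectors at the two points nonpositive. By continuity of the gaps the
limit is the squared norm of the gap at the minimizer, which must vanish. -/
theorem exists_multipliers [IsProbabilityMeasure ℙ]
    (s : System N) (hx : IsFading ℙ x) (hy : IsFading ℙ y) :
    ∃ (lam : Fin N → ℝ) (lam0 : ℝ), (∀ n, 0 < lam n) ∧ 0 ≤ lam0 ∧
      ∀ᵐ ω ∂ℙ, MultiplierEquations s lam lam0 (fun i => x i ω) (fun i => y i ω) := by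
  obtain ⟨θ, hθ, hθ0, hmin⟩ := exists_dual_min s hx hy
  set E := energyGap s ℙ x y with hE
  set D := powerGap s ℙ y with hD
  have hEc : ∀ n, ContinuousAt (fun θ => E θ n) θ := fun n =>
    ((continuousAt_integral_bsPower_mul s hy hθ n).const_mul _).sub
      (ContinuousAt.comp (f := fun θ : (Fin N → ℝ) × ℝ => θ.1)
        (continuousAt_integral_power s hx hθ n) continuousAt_fst)
  have hDc : ContinuousAt D θ := continuousAt_const.sub (continuousAt_integral_bsPower s hy hθ)
  set ray : ℝ → (Fin N → ℝ) × ℝ := fun t => (fun n => θ.1 n - t * E θ n, θ.2 - t * D θ) with hray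
  have hray0 : ray 0 = θ := by simp [hray]
  have hrayc : Tendsto ray (𝓝[>] 0) (𝓝 θ) := by
    have h1 : Continuous ray := by fun_prop
    have h2 := h1.tendsto 0
    rw [hray0] at h2
    exact h2.mono_left nhdsWithin_le_nhds
  have hlim : Tendsto (fun t => ∑ n, E θ n * E (ray t) n + D θ * D (ray t)) (𝓝[>] 0)
      (𝓝 (∑ n, E θ n * E θ n + D θ * D θ)) :=
    (tendsto_finsetSum _ fun n _ => ((hEc n).tendsto.comp hrayc).const_mul _).add
      ((hDc.tendsto.comp hrayc).const_mul _)
  have hev : ∀ᶠ t in 𝓝[>] (0 : ℝ), ∑ n, E θ n * E (ray t) n + D θ * D (ray t) ≤ 0 := by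
    have hpos : ∀ᶠ θ' : (Fin N → ℝ) × ℝ in 𝓝 θ, ∀ n, 0 < θ'.1 n := eventually_all.2 fun n =>
      have h : Continuous fun θ' : (Fin N → ℝ) × ℝ => θ'.1 n := by fun_prop
      (h.tendsto θ).eventually (lt_mem_nhds (hθ n))
    filter_upwards [self_mem_nhdsWithin, hrayc.eventually hpos] with t ht hrt
    have h1 := dual_ge s hx hy hrt hθ
    have h2 := hmin (ray t) hrt
    have h3 : ∑ n, (θ.1 n - (ray t).1 n) * E (ray t) n + (θ.2 - (ray t).2) * D (ray t)
        = t * (∑ n, E θ n * E (ray t) n + D θ * D (ray t)) := by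
      simp only [hray, sub_sub_cancel, mul_add, Finset.mul_sum, mul_assoc]
    have h4 : t * (∑ n, E θ n * E (ray t) n + D θ * D (ray t)) ≤ 0 := by
      rw [← h3]; linarith
    exact nonpos_of_mul_nonpos_right h4 ht
  have hle := le_of_tendsto hlim hev
  have hsum : 0 ≤ ∑ n, E θ n * E θ n := Finset.sum_nonneg fun n _ => mul_self_nonneg _
  have hD0 : D θ = 0 := mul_self_eq_zero.1 (by linarith [mul_self_nonneg (D θ)])
  have hE0 : ∀ n, E θ n = 0 := fun n => mul_self_eq_zero.1
    ((Finset.sum_eq_zero_iff_of_nonneg fun n _ => mul_self_nonneg (E θ n)).1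
      (by linarith [mul_self_nonneg (D θ)]) n (Finset.mem_univ n))
  exact ⟨θ.1, θ.2, hθ, hθ0, ae_multiplierEquations s hx hy hθ
    (fun n => (sub_eq_zero.1 (hE0 n)).symm) (sub_eq_zero.1 hD0).symm⟩

end Dual

end FDT

theorem mainTheorem3 {N : ℕ} (s : FDT.System N) {Ω : Type*} [MeasurableSpace Ω]
    (ℙ : Measure Ω) [IsProbabilityMeasure ℙ] (x y : ℕ → Ω → Fin N → ℝ)
    (hx : FDT.IsFading ℙ x) (hy : FDT.IsFading ℙ y) :
    (∃ (lam : Fin N → ℝ) (lam0 : ℝ), (∀ n, 0 < lam n) ∧ 0 ≤ lam0 ∧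
      ∀ᵐ ω ∂ℙ, FDT.MultiplierEquations s lam lam0 (fun i => x i ω) (fun i => y i ω)) ∧
    ∀ (lam : Fin N → ℝ) (lam0 : ℝ), (∀ n, 0 < lam n) → 0 ≤ lam0 →
      (∀ᵐ ω ∂ℙ, FDT.MultiplierEquations s lam lam0 (fun i => x i ω) (fun i => y i ω)) →
      (∀ᵐ ω ∂ℙ, ∀ i n, 0 < FDT.ehuPower s.μ lam (x i ω) n ↔
        n ∈ FDT.activeSet s.μ lam (x i ω)) ∧
      ∃ R : Fin N → ℝ, ∀ᵐ ω ∂ℙ,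
        (∀ b : Fin N → ℝ, (∀ n, 0 ≤ b n) →
          FDT.IsOptimal s b (fun i => x i ω) (fun i => y i ω)
            (FDT.starPolicy s lam lam0 (fun i => x i ω) (fun i => y i ω)) R) ∧
        FDT.IsOptimalBalanced s (fun i => x i ω) (fun i => y i ω)
          (FDT.starPolicy s lam lam0 (fun i => x i ω) (fun i => y i ω)) R := by
  refine ⟨FDT.exists_multipliers s hx hy, fun lam lam0 hlam hlam0 heq => ⟨?_,
    -- The common rate constant is the mean rate in one slot, so it is deterministic and independent
    -- of the initial battery contents.
    fun n => ∫ ω, FDT.rate (x 0 ω) (FDT.power s.μ lam (x 0 ω)) n ∂ℙ, ?_⟩⟩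
  · filter_upwards [hx.ae_goodGain hlam] with ω hgood i n
    rw [FDT.ehuPower_eq_power s.μ_antitone hlam (hgood i)]
    exact FDT.power_pos_iff hlam (hgood i) n
  · filter_upwards [heq, hx.ae_goodGain hlam, hx.ae_smallTails, FDT.ae_tendsto_avg_rate s hx hlam]
      with ω hω hgood htails hR
    exact ⟨fun b hb => FDT.isOptimal_starPolicy hlam hlam0 hgood htails
      (fun i n => hy.nonneg i ω n) hω hR hb,
      FDT.isOptimalBalanced_starPolicy hlam hlam0 hgood hω hR⟩
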